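/- Let $\mathbb{Q}\langle \mathcal{Y}^{\mathrm{bi}}\rangle$ be the $\mathbb{Q}$-vector space spanned by the words in the letters $y_{k,m}$ ($k\ge 1$, $m\ge 0$), and let $\mathbb{Q}\langle\mathcal{B}\rangle$ be the $\mathbb{Q}$-vector space spanned by the words in the letters $b_0,b_1,b_2,\dots$. Let $\mathbb{Q}\langle\mathcal{B}\rangle^0\subset\mathbb{Q}\langle\mathcal{B}\rangle$ be the subspace spanned by the words that do not start in $b_0$, and let $\mathbf 1$ be the empty word. Products. The stuffle product $*$ on $\mathbb{Q}\langle \mathcal{Y}^{\mathrm{bi}}\rangle$ and the balanced quasi-shuffle product $*_b$ on $\mathbb{Q}\langle\mathcal{B}\rangle$ are the bilinear products with unit $\mathbf 1$ such that, for all words $u,v$, $$y_{k_1,m_1}u * y_{k_2,m_2}v=y_{k_1,m_1}(u*y_{k_2,m_2}v)+y_{k_2,m_2}(y_{k_1,m_1}u*v)+y_{k_1+k_2,m_1+m_2}(u*v),$$ $$b_iu*_b b_jv=b_i(u*_b b_jv)+b_j(b_iu*_b v)+\begin{cases}b_{i+j}(u*_b v)& i,j\ge1,\\ 0&\text{else.}\end{cases}$$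 They are commutative and associative, and $\mathbb{Q}\langle\mathcal{B}\rangle^0$ is a subalgebra for $*_b$. Coproducts. Let $\Delta_{\mathrm{dec}}(w)=\sum_{uv=w}u\otimes v$ be deconcatenation of words. The map $\mathrm{reg}_T:\mathbb{Q}\langle\mathcal{B}\rangle^0[T]\to\mathbb{Q}\langle\mathcal{B}\rangle$, $wT^n\mapsto w*_b b_0^{*_b n}$, is an isomorphism of algebras for $*_b$. Let $\mathrm{reg}:\mathbb{Q}\langle\mathcal{B}\rangle\to\mathbb{Q}\langle\mathcal{B}\rangle^0$ be $\mathrm{reg}_T^{-1}$ followed by $T\mapsto 0$, and let $\Delta^0_{\mathrm{dec}}=(\mathrm{reg}\otimes\mathrm{reg})\circ\Delta_{\mathrm{dec}}$ on $\mathbb{Q}\langle\mathcal{B}\rangle^0$. In both cases the counit is the coefficient of $\mathbf 1$. Weights. The weight of $y_{k_1,m_1}\cdots y_{k_d,m_d}$ is $k_1+\dots+k_d+m_1+\dots+m_d$, and the weight of $b_{s_1}\cdots b_{s_l}$ is $s_1+\dots+s_l+\#\{i\mid s_i=0\}$. Maps. For $d\ge0$ consider the generating series $$\mathfrak{Y}_d\binom{X_1,\dots,X_d}{Y_1,\dots,Y_d}=\sum_{k_i\ge1,\,m_i\ge0}y_{k_1,m_1}\cdots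 y_{k_d,m_d}\prod_{i=1}^d X_i^{k_i-1}\frac{Y_i^{m_i}}{m_i!},\qquad \mathfrak{W}_d\binom{X_1,\dots,X_d}{Y_1,\dots,Y_d}=\sum_{k_i\ge1,\,m_i\ge0}b_{k_1}b_0^{m_1}\cdots b_{k_d}b_0^{m_d}\prod_{i=1}^d X_i^{k_i-1}Y_i^{m_i}.$$ Let $\varphi_\#:\mathbb{Q}\langle \mathcal{Y}^{\mathrm{bi}}\rangle\to\mathbb{Q}\langle\mathcal{B}\rangle^0$ be the linear map that sends $y_{k_1,m_1}\cdots y_{k_d,m_d}$ to the coefficient of $\prod_i X_i^{k_i-1}\frac{Y_i^{m_i}}{m_i!}$ in $$\mathfrak{W}_d\binom{X_1,\,X_2,\,\dots,\,X_d}{Y_1,\,Y_1+Y_2,\,\dots,\,Y_1+\dots+Y_d}.$$ Let $\mathrm{swap}:\mathbb{Q}\langle \mathcal{Y}^{\mathrm{bi}}\rangle\to\mathbb{Q}\langle \mathcal{Y}^{\mathrm{bi}}\rangle$ be the linear map that sends $y_{k_1,m_1}\cdots y_{k_d,m_d}$ to the coefficient of $\prod_i X_i^{k_i-1}\frac{Y_i^{m_i}}{m_i!}$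 in $$\mathfrak{Y}_d\binom{Y_1+\dots+Y_d,\,Y_1+\dots+Y_{d-1},\,\dots,\,Y_1}{X_d,\,X_{d-1}-X_d,\,\dots,\,X_1-X_2}.$$ Let $\tau:\mathbb{Q}\langle\mathcal{B}\rangle^0\to\mathbb{Q}\langle\mathcal{B}\rangle^0$ be the linear map with $\tau(\mathbf 1)=\mathbf 1$ and $\tau(b_{k_1}b_0^{m_1}\cdots b_{k_d}b_0^{m_d})=b_{m_d+1}b_0^{k_d-1}\cdots b_{m_1+1}b_0^{k_1-1}$ for $k_i\ge 1$, $m_i\ge 0$. Theorem. $(\mathbb{Q}\langle \mathcal{Y}^{\mathrm{bi}}\rangle,*,\Delta_{\mathrm{dec}})$ and $(\mathbb{Q}\langle\mathcal{B}\rangle^0,*_b,\Delta^0_{\mathrm{dec}})$ are weight-graded commutative Hopf algebras over $\mathbb{Q}$, and $$\varphi_\#:(\mathbb{Q}\langle \mathcal{Y}^{\mathrm{bi}}\rangle,*,\Delta_{\mathrm{dec}})\to(\mathbb{Q}\langle\mathcal{B}\rangle^0,*_b,\Delta^0_{\mathrm{dec}})$$ is an isomorphism of weight-graded Hopf algebras: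 it is bijective, it is compatible with products, units, coproducts, counits and antipodes, and it maps the subspace of weight $n$ onto the subspace of weight $n$ for every $n\ge 0$. Moreover $$\varphi_\#\circ\mathrm{swap}=\tau\circ\varphi_\#.$$ -/

import Mathlib

open scoped TensorProduct

/-! ## Quasi-shuffle algebras -/

/-- An alphabet with a commutative and associative product of letters. The value `none` stands for
the product `0`, the value `some c` for the letter `c`. -/
class QuasiShuffleAlphabet (α : Type) where
  /-- the product `a ⋄ b` of two letters -/
  dia : α → α → Option α
  dia_comm : ∀ a b, dia a b = dia b a
  dia_assoc : ∀ a b c, (dia a b).bind (fun x => dia x c) = (dia b c).bind (fun x => dia a x)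

/-- The rational vector space `ℚ⟨α⟩` with basis the words (lists) with letters in `α`. The ring
structure put on it below is the quasi-shuffle product (not concatenation). -/
def QSh (α : Type) : Type := List α →₀ ℚ

namespace QSh

noncomputable section

variable {α : Type}

instance : AddCommGroup (QSh α) := inferInstanceAs (AddCommGroup (List α →₀ ℚ))

instance : Module ℚ (QSh α) := inferInstanceAs (Module ℚ (List α →₀ ℚ))

/-- The word `w` as an element of `ℚ⟨α⟩`. -/
def word (w : List α) : QSh α := Finsupp.single w (1 : ℚ)

/-- The linear extension to `ℚ⟨α⟩` of a map defined on words. -/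
def lin {M : Type} [AddCommGroup M] [Module ℚ M] (f : List α → M) : QSh α →ₗ[ℚ] M :=
  Finsupp.linearCombination ℚ f

@[simp] theorem lin_word {M : Type} [AddCommGroup M] [Module ℚ M] (f : List α → M) (w : List α) :
    lin f (word w) = f w :=
  (Finsupp.linearCombination_single ℚ 1 w).trans (one_smul _ _)

theorem lin_ext {M : Type} [AddCommGroup M] [Module ℚ M] {f g : QSh α →ₗ[ℚ] M}
    (h : ∀ w, f (word w) = g (word w)) : f = g :=
  Finsupp.lhom_ext' fun w => LinearMap.ext_ring (h w)

/-- Prepending a letter to all words. -/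
def cons (a : α) : QSh α →ₗ[ℚ] QSh α := lin fun w => word (a :: w)

@[simp] theorem cons_word (a : α) (w : List α) : cons a (word w) = word (a :: w) := by
  simp [cons]

/-- Prepending the product of two letters (which may be `0`) to all words. -/
def consOpt : Option α → (QSh α →ₗ[ℚ] QSh α)
  | none => 0
  | some a => cons a

variable [QuasiShuffleAlphabet α]

open QuasiShuffleAlphabet

/-- The quasi-shuffle product of two words. -/
def mulWord : List α → List α → QSh α
  | [], v => word v
  | a :: u, [] => word (a :: u)
  | a :: u, b :: v =>
      cons a (mulWord u (b :: v)) + cons b (mulWord (a :: u) v) + consOpt (dia a b) (mulWord u v)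
termination_by u v => u.length + v.length

/-- The quasi-shuffle product as a bilinear map. -/
def mulL : QSh α →ₗ[ℚ] QSh α →ₗ[ℚ] QSh α := lin fun u => lin fun v => mulWord u v

theorem mulL_word (u v : List α) : mulL (word u) (word v) = mulWord u v := by
  simp [mulL]

theorem nil_mulL (x : QSh α) : mulL (word []) x = x := by
  have : mulL (word ([] : List α)) = LinearMap.id :=
    lin_ext fun w => by rw [mulL_word]; simp [mulWord]
  rw [this]; rfl

theorem mulL_comm (x y : QSh α) : mulL x y = mulL y x := by
  have key : ∀ (n : ℕ) (u v : List α), u.length + v.length = n → mulWord u v = mulWord v u := by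
    intro n
    induction n using Nat.strong_induction_on with
    | _ n ih =>
      intro u v h
      match u, v with
      | [], [] => rfl
      | [], b :: v => simp [mulWord]
      | a :: u, [] => simp [mulWord]
      | a :: u, b :: v =>
        simp only [List.length_cons] at h
        rw [mulWord, mulWord, dia_comm a b, ih _ (by simp; omega) u (b :: v) rfl,
          ih _ (by simp; omega) (a :: u) v rfl, ih _ (by omega) u v rfl]
        abel
  have : (mulL : QSh α →ₗ[ℚ] _) = mulL.flip := by
    refine lin_ext fun u => lin_ext fun v => ?_
    rw [LinearMap.flip_apply, mulL_word, mulL_word, key _ u v rfl]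
  exact congrArg (fun f => f x y) this

theorem mulL_nil (x : QSh α) : mulL x (word []) = x := by
  rw [mulL_comm, nil_mulL]

/-- The recursion of the quasi-shuffle product. -/
theorem mulL_cons_cons (a b : α) (x y : QSh α) :
    mulL (cons a x) (cons b y) = cons a (mulL x (cons b y)) + cons b (mulL (cons a x) y)
      + consOpt (dia a b) (mulL x y) := by
  have : (mulL.compl₁₂ (cons a) (cons b) : QSh α →ₗ[ℚ] QSh α →ₗ[ℚ] QSh α) =
      (mulL.compl₁₂ LinearMap.id (cons b)).compr₂ (cons a) +
      (mulL.compl₁₂ (cons a) LinearMap.id).compr₂ (cons b) +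
      mulL.compr₂ (consOpt (dia a b)) := by
    refine lin_ext fun u => lin_ext fun v => ?_
    simp [mulL_word, mulWord]
  exact congrArg (fun f => f x y) this

theorem mulL_consOpt_cons (o : Option α) (c : α) (x z : QSh α) :
    mulL (consOpt o x) (cons c z) = consOpt o (mulL x (cons c z)) + cons c (mulL (consOpt o x) z)
      + consOpt (o.bind fun a => dia a c) (mulL x z) := by
  cases o with
  | none => simp [consOpt]
  | some a => simpa [consOpt] using mulL_cons_cons a c x z

theorem mulL_cons_consOpt (a : α) (o : Option α) (x z : QSh α) :
    mulL (cons a x) (consOpt o z) = cons a (mulL x (consOpt o z)) + consOpt o (mulL (cons a x) z)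
      + consOpt (o.bind fun c => dia a c) (mulL x z) := by
  cases o with
  | none => simp [consOpt]
  | some c => simpa [consOpt] using mulL_cons_cons a c x z

theorem mulL_assoc (x y z : QSh α) : mulL (mulL x y) z = mulL x (mulL y z) := by
  have key : ∀ (n : ℕ) (u v w : List α), u.length + v.length + w.length = n →
      mulL (mulL (word u) (word v)) (word w) = mulL (word u) (mulL (word v) (word w)) := by
    intro n
    induction n using Nat.strong_induction_on with
    | _ n ih =>
      intro u v w h
      match u, v, w with
      | [], v, w => simp [nil_mulL]
      | a :: u, [], w => simp [nil_mulL, mulL_nil]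
      | a :: u, b :: v, [] => simp [mulL_nil]
      | a :: u, b :: v, c :: w =>
        simp only [List.length_cons] at h
        have h1 := ih _ (by simp; omega) u (b :: v) (c :: w) rfl
        have h2 := ih _ (by simp; omega) (a :: u) v (c :: w) rfl
        have h3 := ih _ (by simp; omega) (a :: u) (b :: v) w rfl
        have h4 := ih _ (by simp; omega) u v (c :: w) rfl
        have h5 := ih _ (by simp; omega) u (b :: v) w rfl
        have h6 := ih _ (by simp; omega) (a :: u) v w rfl
        have h7 := ih _ (by omega) u v w rfl
        simp only [← cons_word] at h1 h2 h3 h4 h5 h6 h7 ⊢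
        have e1 : mulL (mulL (cons a (word u)) (cons b (word v))) (cons c (word w)) =
            cons a (mulL (mulL (word u) (cons b (word v))) (cons c (word w)))
            + cons b (mulL (mulL (cons a (word u)) (word v)) (cons c (word w)))
            + cons c (mulL (mulL (cons a (word u)) (cons b (word v))) (word w))
            + consOpt (dia a b) (mulL (mulL (word u) (word v)) (cons c (word w)))
            + consOpt (dia a c) (mulL (mulL (word u) (cons b (word v))) (word w))
            + consOpt (dia b c) (mulL (mulL (cons a (word u)) (word v)) (word w))
            + consOpt ((dia a b).bind fun x => dia x c) (mulL (mulL (word u) (word v)) (word w)) := by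
          conv_lhs => rw [mulL_cons_cons a b]
          conv_rhs => enter [1, 1, 1, 1, 2]; rw [mulL_cons_cons a b]
          simp only [map_add, LinearMap.add_apply, mulL_cons_cons _ c, mulL_consOpt_cons _ c]
          abel
        have e2 : mulL (cons a (word u)) (mulL (cons b (word v)) (cons c (word w))) =
            cons a (mulL (word u) (mulL (cons b (word v)) (cons c (word w))))
            + cons b (mulL (cons a (word u)) (mulL (word v) (cons c (word w))))
            + cons c (mulL (cons a (word u)) (mulL (cons b (word v)) (word w)))
            + consOpt (dia a b) (mulL (word u) (mulL (word v) (cons c (word w))))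
            + consOpt (dia a c) (mulL (word u) (mulL (cons b (word v)) (word w)))
            + consOpt (dia b c) (mulL (cons a (word u)) (mulL (word v) (word w)))
            + consOpt ((dia b c).bind fun x => dia a x) (mulL (word u) (mulL (word v) (word w))) := by
          conv_lhs => rw [mulL_cons_cons b c]
          conv_rhs => enter [1, 1, 1, 1, 1, 1]; rw [mulL_cons_cons b c]
          simp only [map_add, mulL_cons_cons a, mulL_cons_consOpt a]
          abel
        rw [e1, e2, dia_assoc, h1, h2, h3, h4, h5, h6, h7]
  have : (mulL.compr₂ mulL : QSh α →ₗ[ℚ] QSh α →ₗ[ℚ] QSh α →ₗ[ℚ] QSh α) =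
      ((LinearMap.llcomp ℚ (QSh α) (QSh α) (QSh α)).flip ∘ₗ mulL).flip ∘ₗ mulL := by
    refine lin_ext fun u => lin_ext fun v => lin_ext fun w => ?_
    simpa using key _ u v w rfl
  simpa using congrArg (fun f => f x y z) this

/-- `ℚ⟨α⟩` with the quasi-shuffle product; the unit is the empty word. -/
instance : CommRing (QSh α) where
  __ := (inferInstance : AddCommGroup (QSh α))
  mul x y := mulL x y
  one := word []
  left_distrib x y z := (mulL x).map_add y z
  right_distrib x y z := by
    change mulL (x + y) z = mulL x z + mulL y z
    simp
  zero_mul x := by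
    change mulL 0 x = 0
    simp
  mul_zero x := (mulL x).map_zero
  mul_assoc := mulL_assoc
  one_mul := nil_mulL
  mul_one := mulL_nil
  mul_comm := mulL_comm

theorem mul_def (x y : QSh α) : x * y = mulL x y := rfl

theorem one_def : (1 : QSh α) = word [] := rfl

instance : Algebra ℚ (QSh α) :=
  Algebra.ofModule
    (fun r x y => by simp [mul_def])
    (fun r x y => by simp [mul_def])

/-- Deconcatenation `w ↦ ∑_{uv = w} u ⊗ v`. -/
def dec : QSh α →ₗ[ℚ] QSh α ⊗[ℚ] QSh α :=
  lin fun w => ∑ i ∈ Finset.range (w.length + 1), word (w.take i) ⊗ₜ[ℚ] word (w.drop i)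

/-- The coefficient of the empty word. -/
def counit : QSh α →ₗ[ℚ] ℚ := Finsupp.lapply []

/-- `ℚ⟨α⟩` with the deconcatenation coproduct. -/
instance : CoalgebraStruct ℚ (QSh α) where
  comul := dec
  counit := counit

/-- The span of all words of weight `n`, the weight of a word being the sum of the weights
of its letters. -/
def grade (wt : α → ℕ) (n : ℕ) : Submodule ℚ (QSh α) :=
  Submodule.span ℚ (word '' {w | (w.map wt).sum = n})

end

end QSh

/-! ## Graded Hopf algebras -/

/-- Given are an algebra `A` over the field `R`, a coproduct and a counit on `A` (a
`CoalgebraStruct`, which has no laws), a linear map `S` and a family `𝒜` of subspaces. The laws say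
that these data form a Hopf algebra with antipode `S`, graded by `𝒜`. -/
structure IsGradedHopfAlgebra (R : Type) {A : Type} [Field R] [CommRing A] [Algebra R A]
    [CoalgebraStruct R A] (S : A →ₗ[R] A) (𝒜 : ℕ → Submodule R A) : Prop where
  coassoc : TensorProduct.assoc R A A A ∘ₗ
      (CoalgebraStruct.comul (R := R) (A := A)).rTensor A ∘ₗ CoalgebraStruct.comul =
      (CoalgebraStruct.comul (R := R) (A := A)).lTensor A ∘ₗ CoalgebraStruct.comul
  rTensor_counit_comp_comul : (CoalgebraStruct.counit (R := R) (A := A)).rTensor A ∘ₗ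
      CoalgebraStruct.comul = TensorProduct.mk R _ _ 1
  lTensor_counit_comp_comul : (CoalgebraStruct.counit (R := R) (A := A)).lTensor A ∘ₗ
      CoalgebraStruct.comul = (TensorProduct.mk R _ _).flip 1
  counit_one : CoalgebraStruct.counit (R := R) (1 : A) = 1
  counit_mul : ∀ x y : A, CoalgebraStruct.counit (R := R) (x * y) =
      CoalgebraStruct.counit (R := R) x * CoalgebraStruct.counit (R := R) y
  comul_one : CoalgebraStruct.comul (R := R) (1 : A) = 1
  comul_mul : ∀ x y : A, CoalgebraStruct.comul (R := R) (x * y) =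
      CoalgebraStruct.comul (R := R) x * CoalgebraStruct.comul (R := R) y
  mul_antipode_rTensor_comul : LinearMap.mul' R A ∘ₗ S.rTensor A ∘ₗ CoalgebraStruct.comul =
      (Algebra.linearMap R A) ∘ₗ CoalgebraStruct.counit
  mul_antipode_lTensor_comul : LinearMap.mul' R A ∘ₗ S.lTensor A ∘ₗ CoalgebraStruct.comul =
      (Algebra.linearMap R A) ∘ₗ CoalgebraStruct.counit
  isInternal : DirectSum.IsInternal 𝒜
  gradedMonoid : SetLike.GradedMonoid 𝒜
  comul_mem : ∀ (n : ℕ) (x : A), x ∈ 𝒜 n → CoalgebraStruct.comul (R := R) x ∈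
      ⨆ (i : ℕ) (j : ℕ) (_ : i + j = n), LinearMap.range (TensorProduct.mapIncl (𝒜 i) (𝒜 j))
  counit_eq_zero : ∀ (n : ℕ) (x : A), x ∈ 𝒜 n → n ≠ 0 → CoalgebraStruct.counit (R := R) x = 0
  antipode_mem : ∀ (n : ℕ) (x : A), x ∈ 𝒜 n → S x ∈ 𝒜 n

/-- Data satisfying these laws are a Hopf algebra in the sense of Mathlib, with the given product,
coproduct, counit and antipode. -/
@[reducible] def IsGradedHopfAlgebra.toHopfAlgebra {R A : Type} [Field R] [CommRing A] [Algebra R A]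
    [CoalgebraStruct R A] {S : A →ₗ[R] A} {𝒜 : ℕ → Submodule R A}
    (h : IsGradedHopfAlgebra R S 𝒜) : HopfAlgebra R A :=
  letI : Coalgebra R A :=
    { (inferInstance : CoalgebraStruct R A) with
      coassoc := h.coassoc
      rTensor_counit_comp_comul := h.rTensor_counit_comp_comul
      lTensor_counit_comp_comul := h.lTensor_counit_comp_comul }
  letI : Bialgebra R A :=
    Bialgebra.mk' R A h.counit_one (h.counit_mul _ _) h.comul_one (h.comul_mul _ _)
  { antipode := S
    mul_antipode_rTensor_comul := h.mul_antipode_rTensor_comul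
    mul_antipode_lTensor_comul := h.mul_antipode_lTensor_comul }

/-! ## The two alphabets -/

/-- The letters `y_{k,m}` with `k ≥ 1` and `m ≥ 0`. -/
@[ext] structure YLetter where
  k : ℕ+
  m : ℕ

/-- `y_{k₁,m₁} ⋄ y_{k₂,m₂} = y_{k₁+k₂,m₁+m₂}`, which gives the stuffle product. -/
instance : QuasiShuffleAlphabet YLetter where
  dia a b := some ⟨a.k + b.k, a.m + b.m⟩
  dia_comm a b := by simp [add_comm]
  dia_assoc a b c := by simp [add_assoc]

/-- The weight `k + m` of the letter `y_{k,m}`. -/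
def YLetter.wt (a : YLetter) : ℕ := a.k + a.m

/-- The letters `b_s` with `s ≥ 0`. -/
@[ext] structure BLetter where
  s : ℕ

/-- `b_i ⋄ b_j = b_{i+j}` if `i, j ≥ 1`, and `0` otherwise, which gives the balanced quasi-shuffle
product. -/
instance : QuasiShuffleAlphabet BLetter where
  dia a b := if 1 ≤ a.s ∧ 1 ≤ b.s then some ⟨a.s + b.s⟩ else none
  dia_comm a b := by simp [and_comm, add_comm]
  dia_assoc a b c := by
    by_cases ha : 1 ≤ a.s <;> by_cases hb : 1 ≤ b.s <;> by_cases hc : 1 ≤ c.s <;>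
      simp [ha, hb, hc, add_assoc, Nat.le_add_right_of_le]

/-- The weight of the letter `b_s`: it is `s` if `s ≥ 1`, and `b_0` has weight `1`. -/
def BLetter.wt (a : BLetter) : ℕ := if a.s = 0 then 1 else a.s

/-- The stuffle algebra `(ℚ⟨Y^bi⟩, ∗)`. -/
abbrev QY : Type := QSh YLetter

/-- The balanced quasi-shuffle algebra `(ℚ⟨B⟩, ∗_b)`. -/
abbrev QB : Type := QSh BLetter

noncomputable section

open QSh QuasiShuffleAlphabet

/-- The letter `b_0`. -/
def b0 : BLetter := ⟨0⟩

/-! ## The algebra `ℚ⟨B⟩⁰` -/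

/-- The span of all words that do not start in `b_0`. -/
def QB0space : Submodule ℚ QB := Submodule.span ℚ (word '' {w | w.head? ≠ some b0})

/-- Auxiliary derivation: delete a leading `b_0`, and map all words not starting in `b_0` to `0`. -/
def strip : QB →ₗ[ℚ] QB := lin fun
  | [] => 0
  | a :: w => if a.s = 0 then word w else 0

theorem strip_cons (a : BLetter) (x : QB) : strip (cons a x) = if a.s = 0 then x else 0 := by
  have : strip ∘ₗ cons a = if a.s = 0 then LinearMap.id else 0 := by
    refine lin_ext fun w => ?_
    simp only [LinearMap.comp_apply, cons_word, strip, lin_word]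
    split_ifs <;> rfl
  have h := congrArg (fun f => f x) this
  simp only [LinearMap.comp_apply] at h
  rw [h]
  split_ifs <;> rfl

theorem strip_nil : strip (word []) = 0 := by simp [strip]

theorem strip_consOpt (a b : BLetter) (x : QB) : strip (consOpt (dia a b) x) = 0 := by
  by_cases h : 1 ≤ a.s ∧ 1 ≤ b.s
  · have : dia a b = some ⟨a.s + b.s⟩ := if_pos h
    rw [this, consOpt, strip_cons, if_neg]
    simp only
    omega
  · have : dia a b = none := if_neg h
    rw [this]
    simp [consOpt]

theorem consOpt_b0_left {a b : BLetter} (h : a.s = 0) (x : QB) : consOpt (dia a b) x = 0 := by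
  have : dia a b = none := if_neg (by omega)
  simp [this, consOpt]

theorem strip_mul (x y : QB) : strip (x * y) = strip x * y + x * strip y := by
  have : (mulL.compr₂ strip : QB →ₗ[ℚ] QB →ₗ[ℚ] QB) = mulL ∘ₗ strip + mulL.compl₂ strip := by
    refine lin_ext fun u => lin_ext fun v => ?_
    simp only [LinearMap.compr₂_apply, LinearMap.add_apply, LinearMap.comp_apply,
      LinearMap.compl₂_apply]
    match u, v with
    | [], v => simp [nil_mulL, strip_nil]
    | a :: u, [] => simp [mulL_nil, strip_nil]
    | a :: u, b :: v =>
      rw [← cons_word, ← cons_word, mulL_cons_cons]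
      simp only [map_add, strip_consOpt, strip_cons, add_zero]
      split_ifs <;> simp [add_comm]
  exact congrArg (fun f => f x y) this

theorem mem_QB0space_iff (x : QB) : x ∈ QB0space ↔ strip x = 0 := by
  constructor
  · intro h
    induction h using Submodule.span_induction with
    | mem x hx =>
      obtain ⟨w, hw, rfl⟩ := hx
      match w with
      | [] => exact strip_nil
      | a :: w =>
        rw [← cons_word, strip_cons, if_neg]
        intro h0
        apply hw
        cases a
        simp_all [b0]
    | zero => simp
    | add x y _ _ hx hy => simp [hx, hy]
    | smul r x _ hx => simp [hx]
  · intro h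
    have key : ∀ y : QB, y - cons b0 (strip y) ∈ QB0space := by
      intro y
      have : QB0space.mkQ ∘ₗ (LinearMap.id - cons b0 ∘ₗ strip) = 0 := by
        refine lin_ext fun w => ?_
        simp only [LinearMap.comp_apply, LinearMap.zero_apply, Submodule.mkQ_apply,
          Submodule.Quotient.mk_eq_zero, LinearMap.sub_apply, LinearMap.id_apply]
        match w with
        | [] =>
          rw [strip_nil]
          rw [map_zero, sub_zero]
          exact Submodule.subset_span ⟨[], by simp, rfl⟩
        | a :: w =>
          rw [← cons_word, strip_cons]
          split_ifs with h0
          · have : a = b0 := by cases a; simp_all [b0]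
            simp [this]
          · rw [map_zero, sub_zero, cons_word]
            refine Submodule.subset_span ⟨a :: w, ?_, rfl⟩
            simp only [List.head?_cons, ne_eq, Option.some.injEq, Set.mem_ofPred_eq]
            rintro rfl
            exact h0 rfl
      have h2 := congrArg (fun f => f y) this
      exact (Submodule.Quotient.mk_eq_zero _).1 h2
    simpa [h] using key x

/-- The algebra `(ℚ⟨B⟩⁰, ∗_b)`, spanned by all words that do not start in `b_0`. -/
def QB0 : Subalgebra ℚ QB :=
  QB0space.toSubalgebra (Submodule.subset_span ⟨[], by simp, rfl⟩) fun x y hx hy => by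
    rw [mem_QB0space_iff] at *
    simp [strip_mul, hx, hy]

theorem mem_QB0_iff (x : QB) : x ∈ QB0 ↔ strip x = 0 := mem_QB0space_iff x

theorem word_mem_QB0 {w : List BLetter} (h : w.head? ≠ some b0) : word w ∈ QB0 :=
  Submodule.subset_span ⟨w, h, rfl⟩

/-! ## Regularization -/

/-- The map `ℚ⟨B⟩⁰[T] → ℚ⟨B⟩`, `w Tⁿ ↦ w ∗_b b_0^{∗_b n}`. -/
def regT : Polynomial QB0 →ₐ[QB0] QB := Polynomial.aeval (word [b0])

theorem strip_b0 : strip (word [b0]) = 1 := by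
  rw [← cons_word, strip_cons, if_pos (show b0.s = 0 from rfl), one_def]

theorem strip_regT (p : Polynomial QB0) : strip (regT p) = regT (Polynomial.derivative p) := by
  let D : Derivation ℚ QB QB := Derivation.mk' strip fun x y => by
    rw [strip_mul, smul_eq_mul, smul_eq_mul, mul_comm (strip x), add_comm]
  have hD : ∀ x, D x = strip x := fun _ => rfl
  induction p using Polynomial.induction_on' with
  | add p q hp hq => simp [hp, hq]
  | monomial n a =>
    have ha : strip (a : QB) = 0 := (mem_QB0_iff _).1 a.2
    have hp : strip (word [b0] ^ n) = n * word [b0] ^ (n - 1) := by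
      rw [← hD, Derivation.leibniz_pow, hD, strip_b0]
      simp
    simp only [regT, Polynomial.derivative_monomial, Polynomial.aeval_monomial]
    rw [show (algebraMap QB0 QB) a = (a : QB) from rfl, strip_mul, ha, hp]
    simp [mul_assoc, show ∀ x, (algebraMap QB0 QB) x = (x : QB) from fun _ => rfl]

theorem regT_bijective : Function.Bijective regT := by
  constructor
  · rw [injective_iff_map_eq_zero]
    have key : ∀ (n : ℕ) (p : Polynomial QB0), p.natDegree ≤ n → regT p = 0 → p = 0 := by
      intro n
      induction n with
      | zero =>
        intro p hp h
        rw [Polynomial.eq_C_of_natDegree_le_zero hp] at h ⊢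
        rw [regT, Polynomial.aeval_C] at h
        rw [Subtype.ext (a1 := p.coeff 0) (a2 := 0) h, Polynomial.C_0]
      | succ n ih =>
        intro p hp h
        have h1 : Polynomial.derivative p = 0 := by
          refine ih _ ((Polynomial.natDegree_derivative_le p).trans (by omega)) ?_
          rw [← strip_regT, h, map_zero]
        have : IsAddTorsionFree QB0 := IsAddTorsionFree.of_module_rat _
        have h2 := Polynomial.derivative_eq_zero.1 h1
        rw [Polynomial.eq_C_of_natDegree_le_zero h2.le] at h ⊢
        rw [regT, Polynomial.aeval_C] at h
        rw [Subtype.ext (a1 := p.coeff 0) (a2 := 0) h, Polynomial.C_0]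
    exact fun p => key _ p le_rfl
  · have anti : ∀ q : Polynomial QB0, ∃ p, Polynomial.derivative p = q := by
      intro q
      induction q using Polynomial.induction_on' with
      | add p q hp hq =>
        obtain ⟨p', rfl⟩ := hp
        obtain ⟨q', rfl⟩ := hq
        exact ⟨p' + q', by simp⟩
      | monomial n a =>
        refine ⟨Polynomial.monomial (n + 1) ((1 / (n + 1 : ℚ)) • a), ?_⟩
        rw [Polynomial.derivative_monomial]
        have : (n + 1 : ℚ) ≠ 0 := by positivity
        have h : (((n + 1 : ℕ)) : QB0) = (n + 1 : ℚ) • (1 : QB0) := by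
          rw [← Algebra.algebraMap_eq_smul_one]
          simp
        rw [h, smul_mul_smul_comm, mul_one, one_div, inv_mul_cancel₀ this, one_smul,
          Nat.add_sub_cancel]
    have key : ∀ x, strip x ∈ LinearMap.range regT.toLinearMap →
        x ∈ LinearMap.range regT.toLinearMap := by
      rintro x ⟨q, hq⟩
      obtain ⟨p, rfl⟩ := anti q
      have hx : x - regT p ∈ QB0 := by
        rw [mem_QB0_iff, map_sub, strip_regT, sub_eq_zero]
        exact hq.symm
      refine ⟨p + Polynomial.C ⟨_, hx⟩, ?_⟩
      have : regT (Polynomial.C ⟨_, hx⟩) = x - regT p := Polynomial.aeval_C _ _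
      simp [this]
    have hw : ∀ w : List BLetter, word w ∈ LinearMap.range regT.toLinearMap := by
      intro w
      induction w with
      | nil => exact key _ (by rw [strip_nil]; exact zero_mem _)
      | cons a w ih =>
        refine key _ ?_
        rw [← cons_word, strip_cons]
        split_ifs
        · exact ih
        · exact zero_mem _
    have hall : ((LinearMap.range regT.toLinearMap).restrictScalars ℚ).mkQ = 0 := by
      refine lin_ext fun w => ?_
      simpa using hw w
    intro x
    have := congrArg (fun f => f x) hall
    simpa using this

/-- The regularization map `ℚ⟨B⟩ → ℚ⟨B⟩⁰`: the inverse of `regT`, followed by `T = 0`. -/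
def reg : QB →ₐ[ℚ] QB0 :=
  (((Polynomial.aeval (0 : QB0) : Polynomial QB0 →ₐ[QB0] QB0)).comp
    (AlgEquiv.ofBijective regT regT_bijective).symm.toAlgHom).restrictScalars ℚ

/-- The regularized coproduct `(reg ⊗ reg) ∘ Δ_dec`, and the coefficient of the empty word. -/
instance : CoalgebraStruct ℚ QB0 where
  comul := TensorProduct.map reg.toLinearMap reg.toLinearMap ∘ₗ dec ∘ₗ QB0.val.toLinearMap
  counit := QSh.counit ∘ₗ QB0.val.toLinearMap

/-- The weight grading of `ℚ⟨Y^bi⟩`. -/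
def gradeY (n : ℕ) : Submodule ℚ QY := QSh.grade YLetter.wt n

/-- The weight grading of `ℚ⟨B⟩⁰`, induced from `ℚ⟨B⟩`. -/
def gradeB0 (n : ℕ) : Submodule ℚ QB0 :=
  (QSh.grade BLetter.wt n).comap QB0.val.toLinearMap

/-! ## The involution `τ` -/

/-- The word `b_{k₁} b_0^{m₁} … b_{k_d} b_0^{m_d}` for the list `(k₁, m₁), …, (k_d, m_d)`. -/
def blockWord (l : List (ℕ+ × ℕ)) : List BLetter :=
  l.flatMap fun p => ⟨(p.1 : ℕ)⟩ :: List.replicate p.2 b0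

theorem blockWord_head (l : List (ℕ+ × ℕ)) : (blockWord l).head? ≠ some b0 := by
  cases l with
  | nil => simp [blockWord]
  | cons p l => simp [blockWord, b0]

/-- The word `b_{k₁} b_0^{m₁} … b_{k_d} b_0^{m_d}` as an element of `ℚ⟨B⟩⁰`. -/
def block (l : List (ℕ+ × ℕ)) : QB0 := ⟨word (blockWord l), word_mem_QB0 (blockWord_head l)⟩

/-- Reads a word from the right: `b_0^m b_{k₁} b_0^{m₁} … b_{k_d} b_0^{m_d}` is decomposed into `m`
and the list `(k₁, m₁), …, (k_d, m_d)`. -/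
def decompose (w : List BLetter) : ℕ × List (ℕ+ × ℕ) :=
  w.foldr (fun a r => if h : 0 < a.s then (0, (⟨a.s, h⟩, r.1) :: r.2) else (r.1 + 1, r.2)) (0, [])

theorem decompose_blockWord (l : List (ℕ+ × ℕ)) : decompose (blockWord l) = (0, l) := by
  induction l with
  | nil => rfl
  | cons p l ih =>
    have h : ∀ m, decompose (List.replicate m b0 ++ blockWord l) = (m, l) := by
      intro m
      induction m with
      | zero => simpa using ih
      | succ m ihm =>
        simp only [List.replicate_succ, List.cons_append, decompose, List.foldr_cons] at ihm ⊢
        rw [ihm]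
        simp [b0]
    have e : blockWord (p :: l) = ⟨(p.1 : ℕ)⟩ :: (List.replicate p.2 b0 ++ blockWord l) := by
      simp [blockWord]
    have h' := h p.2
    rw [e]
    simp only [decompose, List.foldr_cons] at h' ⊢
    rw [h']
    simp only [PNat.pos, dite_true]
    rfl

/-- The list `(m_d + 1, k_d - 1), …, (m₁ + 1, k₁ - 1)` for the list `(k₁, m₁), …, (k_d, m_d)`. -/
def flipBlocks (l : List (ℕ+ × ℕ)) : List (ℕ+ × ℕ) :=
  (l.map fun p => (p.2.succPNat, p.1.natPred)).reverse

/-- The linear map `τ` on `ℚ⟨B⟩⁰`, see `tau_block` for its values on words. -/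
def tau : QB0 →ₗ[ℚ] QB0 :=
  (lin fun w => block (flipBlocks (decompose w).2) : QB →ₗ[ℚ] QB0) ∘ₗ QB0.val.toLinearMap

theorem tau_block (l : List (ℕ+ × ℕ)) : tau (block l) = block (flipBlocks l) := by
  change lin _ (word (blockWord l)) = _
  rw [lin_word, decompose_blockWord]

/-! ## Bimoulds and generating series of words -/

/-- Formal power series in `X_1, …, X_d, Y_1, …, Y_d` with coefficients in `R`. -/
abbrev BiSeries (R : Type) (d : ℕ) : Type := MvPowerSeries (Fin d ⊕ Fin d) R

/-- The variable `X_{i+1}`. -/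
def varX {R : Type} [CommRing R] {d : ℕ} (i : Fin d) : BiSeries R d := MvPowerSeries.X (Sum.inl i)

/-- The variable `Y_{i+1}`. -/
def varY {R : Type} [CommRing R] {d : ℕ} (i : Fin d) : BiSeries R d := MvPowerSeries.X (Sum.inr i)

/-- A bimould with coefficients in `R`. -/
abbrev Bimould (R : Type) : Type := (d : ℕ) → BiSeries R d

/-- The exponent of the monomial `X_1^{k₁-1} Y_1^{m₁} … X_d^{k_d-1} Y_d^{m_d}` for the word
`w = y_{k₁,m₁} … y_{k_d,m_d}`. -/
def expo (w : List YLetter) : Fin w.length ⊕ Fin w.length →₀ ℕ :=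
  Finsupp.equivFunOnFinite.symm (Sum.elim (fun i => (w.get i).k.natPred) (fun i => (w.get i).m))

/-- The bimould of generating series of words in `ℚ⟨Y^bi⟩`: the coefficient of
`X_1^{k₁-1} Y_1^{m₁} … X_d^{k_d-1} Y_d^{m_d}` is `y_{k₁,m₁} … y_{k_d,m_d} / (m₁! … m_d!)`. -/
def genY : Bimould QY := fun _ e =>
  (∏ i, ((e (Sum.inr i)).factorial : ℚ))⁻¹ •
    word (List.ofFn fun i => YLetter.mk (e (Sum.inl i)).succPNat (e (Sum.inr i)))

/-- The bimould of generating series of words in `ℚ⟨B⟩⁰`: the coefficient of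
`X_1^{k₁-1} Y_1^{m₁} … X_d^{k_d-1} Y_d^{m_d}` is `b_{k₁} b_0^{m₁} … b_{k_d} b_0^{m_d}`. -/
def genB0 : Bimould QB0 := fun _ e =>
  block (List.ofFn fun i => ((e (Sum.inl i)).succPNat, e (Sum.inr i)))

/-- The linear map on `ℚ⟨Y^bi⟩` that sends the word `y_{k₁,m₁} … y_{k_d,m_d}` to the coefficient of
`X_1^{k₁-1} Y_1^{m₁}/m₁! … X_d^{k_d-1} Y_d^{m_d}/m_d!` in the bimould `M`. -/
def coeffMap {R : Type} [CommRing R] [Algebra ℚ R] (M : Bimould R) : QY →ₗ[ℚ] R :=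
  lin fun w => (w.map fun a => (a.m.factorial : ℚ)).prod •
    MvPowerSeries.coeff (expo w) (M w.length)

/-- The substitution `X_i ↦ X_i`, `Y_i ↦ Y_1 + … + Y_i`. -/
def sharpVar (R : Type) [CommRing R] (d : ℕ) : Fin d ⊕ Fin d → BiSeries R d :=
  Sum.elim (fun i => varX i) (fun i => ∑ j ∈ Finset.Iic i, varY j)

/-- The substitution of `(Y_1 + … + Y_d, Y_1 + … + Y_{d-1}, …, Y_1)` for `(X_1, …, X_d)` and of
`(X_d, X_{d-1} - X_d, …, X_1 - X_2)` for `(Y_1, …, Y_d)`. -/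
def swapVar (R : Type) [CommRing R] (d : ℕ) : Fin d ⊕ Fin d → BiSeries R d :=
  Sum.elim (fun i => ∑ j ∈ Finset.Iic i.rev, varY j)
    (fun i => varX i.rev - if h : (i.rev : ℕ) + 1 < d then varX ⟨i.rev + 1, h⟩ else 0)

theorem hasSubst_sharpVar (R : Type) [CommRing R] (d : ℕ) :
    MvPowerSeries.HasSubst (sharpVar R d) :=
  MvPowerSeries.hasSubst_of_constantCoeff_zero fun i => by
    cases i <;> simp [sharpVar, varX, varY]

theorem hasSubst_swapVar (R : Type) [CommRing R] (d : ℕ) :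
    MvPowerSeries.HasSubst (swapVar R d) :=
  MvPowerSeries.hasSubst_of_constantCoeff_zero fun i => by
    cases i with
    | inl i => simp [swapVar, varY]
    | inr i =>
      simp only [swapVar, varX, Sum.elim_inr]
      split_ifs <;> simp

/-- The bimould `M^{#_Y}`. -/
def sharp {R : Type} [CommRing R] (M : Bimould R) : Bimould R := fun d =>
  (M d).subst (sharpVar R d)

/-- The bimould `swap M`. -/
def swapBimould {R : Type} [CommRing R] (M : Bimould R) : Bimould R := fun d =>
  (M d).subst (swapVar R d)

/-- The linear map `φ_# : ℚ⟨Y^bi⟩ → ℚ⟨B⟩⁰`. -/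
def phiSharp : QY →ₗ[ℚ] QB0 := coeffMap (sharp genB0)

/-- The linear map `swap : ℚ⟨Y^bi⟩ → ℚ⟨Y^bi⟩`. -/
def swapY : QY →ₗ[ℚ] QY := coeffMap (swapBimould genY)

end

/-! Everything is controlled by deleting last letters. An element of `QSh α` is determined by its
coefficient at the empty word and its images under all operators `rstrip a`, so two linear maps
agree once they have the same counit and obey the same recursion under deletion. Since `rstrip a` is
a slice of the multiplicative coproduct `dec`, it obeys a product rule: on ℚ⟨B⟩, deleting b_0 is a
derivation, and deleting b_k for k ≥ 1 obeys the Leibniz rule with extra terms indexed by i + j = k.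

The map φ_# translates these operators. On generating series, deleting b_0 multiplies 𝔚_d by Y_d;
the substitution turns this factor into Y_1 + … + Y_d, which is how the derivation `derivY` (y_{k,m}
↦ m y_{k,m-1}) acts on 𝔜_d. Deleting b_k corresponds to deleting y_{k,0}. These two intertwining
relations, `rstrip_b0_comp_phiQB` and `rstrip_bPos_comp_phiQB`, carry the proof.

Multiplicativity (`phiQB_mul`) and compatibility with weights (`phiQB_gradeProj`) follow by
induction on words read from the right, because the operators on the two sides obey the same rules.
For injectivity, the kernel is stable under `derivY` and deletion of y_{k,0}; the commutator formula
`rstrip_derivY` then makes it stable under every deletion, hence zero. For surjectivity, `derivY`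
has antiderivatives (`exists_derivY_eq`), which makes the image stable under appending b_k, and
under appending b_0 to elements without constant term.

For coproducts, `derivY` is a coderivation of `dec`. Deletion of b_0 is a coderivation of the
regularized coproduct on ℚ⟨B⟩⁰ (`rstrip_b0_regDec`): the correction caused by regularization in the
right tensor factor is the action on the left factor. The two sides of `regDec_phiQB` therefore obey
the same recursion. The Hopf algebra laws on ℚ⟨B⟩⁰ are not checked directly but transported from the
quasi-shuffle Hopf algebra ℚ⟨Y^bi⟩ along φ_#.

The relation between swap and τ is a computation with variables: τ exchanges X_i with Y_{d+1-i} in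
𝔚_d, and the substitutions defining swap and φ_# compose accordingly (`subst_swapVar_sharpVar`), by
telescoping. -/

namespace QSh

noncomputable section

open QuasiShuffleAlphabet TensorProduct

/-! ### The deconcatenation coalgebra. -/

section Words

variable {α : Type}

/-- The coefficient of the word `w`. -/
def coeff (w : List α) : QSh α →ₗ[ℚ] ℚ := Finsupp.lapply w

theorem coeff_word [DecidableEq α] (v w : List α) :
    coeff v (word w) = if w = v then (1 : ℚ) else 0 := by
  classical
  refine (Finsupp.single_apply (a := w) (a' := v) (b := (1 : ℚ))).trans ?_
  congr

theorem ext_coeff {x : QSh α} (h : ∀ w, coeff w x = 0) : x = 0 := Finsupp.ext h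

theorem word_induction {p : QSh α → Prop} (zero : p 0) (add : ∀ x y, p x → p y → p (x + y))
    (smul : ∀ (r : ℚ) x, p x → p (r • x)) (hw : ∀ w, p (word w)) (x : QSh α) : p x := by
  induction x using Finsupp.induction_linear with
  | zero => exact zero
  | add x y hx hy => exact add x y hx hy
  | single w r =>
    have : (Finsupp.single w r : List α →₀ ℚ) = r • (word w : QSh α) := by
      change _ = r • Finsupp.single w (1 : ℚ)
      rw [Finsupp.smul_single, smul_eq_mul, mul_one]
    rw [this]
    exact smul r _ (hw w)

variable [QuasiShuffleAlphabet α]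

theorem counit_eq_coeff : (counit : QSh α →ₗ[ℚ] ℚ) = coeff [] := rfl

theorem counit_nil : counit (word ([] : List α)) = 1 := by
  classical
  simp [counit_eq_coeff, coeff_word]

theorem counit_word_cons (a : α) (w : List α) : counit (word (a :: w)) = 0 := by
  classical
  simp [counit_eq_coeff, coeff_word]

theorem counit_cons (a : α) (x : QSh α) : counit (cons a x) = 0 := by
  have : counit ∘ₗ cons a = 0 := lin_ext fun w => by simp [counit_word_cons]
  exact congrArg (fun f => f x) this

theorem dec_nil : dec (word ([] : List α)) = word [] ⊗ₜ[ℚ] word [] := by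
  simp [dec]

theorem dec_cons (a : α) (x : QSh α) :
    dec (cons a x) = (cons a).rTensor (QSh α) (dec x) + word [] ⊗ₜ[ℚ] cons a x := by
  have : dec ∘ₗ cons a = (cons a).rTensor (QSh α) ∘ₗ dec +
      TensorProduct.mk ℚ (QSh α) (QSh α) (word []) ∘ₗ cons a := by
    refine lin_ext fun w => ?_
    simp only [LinearMap.comp_apply, cons_word, LinearMap.add_apply, TensorProduct.mk_apply, dec,
      lin_word, map_sum, LinearMap.rTensor_tmul, List.length_cons]
    rw [Finset.sum_range_succ']
    simp
  exact congrArg (fun f => f x) this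

/-- Coassociativity is proved along the recursion `dec_cons`; this is the recursion step for the
reassociated side, in which `dec` acts on the left factor. -/
theorem assoc_dec_rTensor_cons (a : α) (t : QSh α ⊗[ℚ] QSh α) :
    TensorProduct.assoc ℚ _ _ _ (dec.rTensor (QSh α) ((cons a).rTensor (QSh α) t)) =
      (cons a).rTensor _ (TensorProduct.assoc ℚ _ _ _ (dec.rTensor (QSh α) t)) +
        word [] ⊗ₜ[ℚ] (cons a).rTensor (QSh α) t := by
  induction t with
  | zero => simp
  | add x y hx hy => simp only [map_add, hx, hy, tmul_add]; abel
  | tmul x y =>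
    simp only [LinearMap.rTensor_tmul, dec_cons, add_tmul, map_add, assoc_tmul]
    congr 1
    induction dec x with
    | zero => simp
    | add x y hx hy => simp only [map_add, hx, hy, add_tmul]
    | tmul x y => simp

theorem coassoc_dec : (TensorProduct.assoc ℚ (QSh α) (QSh α) (QSh α)).toLinearMap ∘ₗ
    dec.rTensor (QSh α) ∘ₗ dec = dec.lTensor (QSh α) ∘ₗ dec := by
  refine lin_ext fun w => ?_
  induction w with
  | nil => simp [dec_nil]
  | cons a w ih =>
    simp only [LinearMap.comp_apply, LinearEquiv.coe_coe] at ih ⊢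
    rw [← cons_word, dec_cons, map_add, map_add, assoc_dec_rTensor_cons, ih, map_add,
      LinearMap.rTensor_tmul, LinearMap.lTensor_tmul, dec_nil, dec_cons, assoc_tmul, tmul_add,
      ← add_assoc]
    congr 2
    rw [← LinearMap.comp_apply, LinearMap.rTensor_comp_lTensor,
      ← LinearMap.lTensor_comp_rTensor, LinearMap.comp_apply]

theorem rTensor_counit_dec :
    (counit : QSh α →ₗ[ℚ] ℚ).rTensor (QSh α) ∘ₗ dec = TensorProduct.mk ℚ _ _ 1 := by
  refine lin_ext fun w => ?_
  cases w with
  | nil => simp [dec_nil, counit_nil]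
  | cons a w =>
    have : counit.rTensor (QSh α) ∘ₗ (cons a).rTensor (QSh α) = 0 := by
      rw [← LinearMap.rTensor_comp, show counit ∘ₗ cons a = 0 from
        LinearMap.ext (counit_cons a), LinearMap.rTensor_zero]
    have h := congrArg (fun f => f (dec (word w))) this
    simp only [LinearMap.comp_apply, LinearMap.zero_apply] at h
    simp [← cons_word, dec_cons, h, counit_nil]

theorem lTensor_counit_dec :
    (counit : QSh α →ₗ[ℚ] ℚ).lTensor (QSh α) ∘ₗ dec = (TensorProduct.mk ℚ _ _).flip 1 := by
  refine lin_ext fun w => ?_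
  induction w with
  | nil => simp [dec_nil, counit_nil]
  | cons a w ih =>
    simp only [LinearMap.comp_apply, LinearMap.flip_apply, mk_apply] at ih ⊢
    rw [← cons_word, dec_cons, map_add, LinearMap.lTensor_tmul, counit_cons, tmul_zero, add_zero,
      ← LinearMap.comp_apply, LinearMap.lTensor_comp_rTensor, ← LinearMap.rTensor_comp_lTensor,
      LinearMap.comp_apply, ih, LinearMap.rTensor_tmul]

instance : Coalgebra ℚ (QSh α) where
  coassoc := coassoc_dec
  rTensor_counit_comp_comul := rTensor_counit_dec
  lTensor_counit_comp_comul := lTensor_counit_dec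

end Words

/-! ### Multiplicativity of the counit and of deconcatenation. -/

section Product

variable {α : Type} [QuasiShuffleAlphabet α]

theorem cons_mul_cons (a b : α) (x y : QSh α) :
    cons a x * cons b y = cons a (x * cons b y) + cons b (cons a x * y)
      + consOpt (dia a b) (x * y) := mulL_cons_cons a b x y

theorem counit_consOpt (o : Option α) (x : QSh α) : counit (consOpt o x) = 0 := by
  cases o with
  | none => simp [consOpt]
  | some a => exact counit_cons a x

/-- Linearity in each argument reduces to words, and induction on the total length then follows the
recursion of the product. Stating the recursive case for arbitrary elements lets identities of
products be checked without unfolding words. -/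
theorem mul_induction {p : QSh α → QSh α → Prop}
    (zero_left : ∀ y, p 0 y) (add_left : ∀ x x' y, p x y → p x' y → p (x + x') y)
    (smul_left : ∀ (r : ℚ) x y, p x y → p (r • x) y)
    (zero_right : ∀ x, p x 0) (add_right : ∀ x y y', p x y → p x y' → p x (y + y'))
    (smul_right : ∀ (r : ℚ) x y, p x y → p x (r • y))
    (nil_left : ∀ y, p 1 y) (nil_right : ∀ x, p x 1)
    (cons_cons : ∀ a b x y, p x (cons b y) → p (cons a x) y → p x y → p (cons a x) (cons b y))
    (x y : QSh α) : p x y := by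
  have key : ∀ (n : ℕ) (u v : List α), u.length + v.length = n → p (word u) (word v) := by
    intro n
    induction n using Nat.strong_induction_on with
    | _ n ih =>
      intro u v h
      match u, v with
      | [], v => exact nil_left _
      | u, [] => exact nil_right _
      | a :: u, b :: v =>
        simp only [List.length_cons] at h
        have h1 := ih _ (by simp; omega) u (b :: v) rfl
        have h2 := ih _ (by simp; omega) (a :: u) v rfl
        rw [← cons_word] at h1 h2
        rw [← cons_word, ← cons_word]
        exact cons_cons a b _ _ h1 h2 (ih _ (by omega) u v rfl)
  refine word_induction (p := fun x => p x y) (zero_left y) (fun x x' => add_left x x' y)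
    (fun r x => smul_left r x y) (fun u => ?_) x
  exact word_induction (p := fun y => p (word u) y) (zero_right _) (add_right _)
    (fun r y => smul_right r _ y) (fun v => key _ u v rfl) y

theorem counit_mul (x y : QSh α) : counit (x * y) = counit x * counit y := by
  have h1 : counit (1 : QSh α) = 1 := counit_nil
  induction x, y using mul_induction with
  | zero_left y => simp
  | add_left x x' y h h' => simp only [add_mul, map_add, h, h']
  | smul_left r x y h => simp [h, mul_assoc]
  | zero_right x => simp
  | add_right x y y' h h' => simp only [mul_add, map_add, h, h']
  | smul_right r x y h => simp [h, mul_left_comm]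
  | nil_left y => simp [h1]
  | nil_right x => simp [h1]
  | cons_cons a b x y => simp [cons_mul_cons, counit_cons, counit_consOpt]

theorem dec_one : dec (1 : QSh α) = 1 := dec_nil

theorem rTensor_cons_mul (a b : α) (s t : QSh α ⊗[ℚ] QSh α) :
    (cons a).rTensor (QSh α) s * (cons b).rTensor (QSh α) t =
      (cons a).rTensor (QSh α) (s * (cons b).rTensor (QSh α) t) +
      (cons b).rTensor (QSh α) ((cons a).rTensor (QSh α) s * t) +
      (consOpt (dia a b)).rTensor (QSh α) (s * t) := by
  induction s with
  | zero => simp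
  | add s s' h h' => simp only [map_add, add_mul, h, h']; abel
  | tmul x y =>
    induction t with
    | zero => simp
    | add s s' h h' => simp only [map_add, mul_add, h, h']; abel
    | tmul x' y' =>
      simp only [LinearMap.rTensor_tmul, Algebra.TensorProduct.tmul_mul_tmul, cons_mul_cons,
        add_tmul]

theorem rTensor_mul_one_tmul (f : QSh α →ₗ[ℚ] QSh α) (s : QSh α ⊗[ℚ] QSh α) (z : QSh α) :
    f.rTensor (QSh α) s * (1 ⊗ₜ[ℚ] z) = f.rTensor (QSh α) (s * (1 ⊗ₜ[ℚ] z)) := by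
  induction s with
  | zero => simp
  | add s s' h h' => simp only [map_add, add_mul, h, h']
  | tmul x y => simp

theorem one_tmul_mul_rTensor (f : QSh α →ₗ[ℚ] QSh α) (s : QSh α ⊗[ℚ] QSh α) (z : QSh α) :
    (1 ⊗ₜ[ℚ] z) * f.rTensor (QSh α) s = f.rTensor (QSh α) ((1 ⊗ₜ[ℚ] z) * s) := by
  rw [mul_comm, rTensor_mul_one_tmul, mul_comm s]

theorem dec_consOpt (o : Option α) (x : QSh α) :
    dec (consOpt o x) = (consOpt o).rTensor (QSh α) (dec x) + 1 ⊗ₜ[ℚ] consOpt o x := by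
  cases o with
  | none => simp [consOpt]
  | some a => exact dec_cons a x

/-- Each coproduct splits into a part where the first letter stays in the left factor and a part 1 ⊗
(whole element). The product of the first parts follows the quasi-shuffle recursion in the left
factor, the mixed products supply what is missing from its terms, and the product of the second
parts is 1 ⊗ (product). -/
theorem dec_mul (x y : QSh α) : dec (x * y) = dec x * dec y := by
  induction x, y using mul_induction with
  | zero_left y => simp
  | add_left x x' y h h' => simp only [add_mul, map_add, h, h']
  | smul_left r x y h => 
    rw [smul_mul_assoc, map_smul, map_smul, h]
    exact (Algebra.smul_mul_assoc r (dec x) (dec y)).symm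
  | zero_right x => simp
  | add_right x y y' h h' => simp only [mul_add, map_add, h, h']
  | smul_right r x y h => 
    rw [mul_smul_comm, map_smul, map_smul, h]
    exact (Algebra.mul_smul_comm r (dec x) (dec y)).symm
  | nil_left y => simp [dec_one]
  | nil_right x => simp [dec_one]
  | cons_cons a b x y h1 h2 h3 =>
    have e : ∀ (c : α) z, dec (cons c z) =
      (cons c).rTensor (QSh α) (dec z) + 1 ⊗ₜ[ℚ] cons c z := dec_cons
    rw [cons_mul_cons, map_add, map_add, dec_consOpt, h3, e a (_ * _), e b (_ * _), h1, h2,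
      e a, e b]
    simp only [mul_add, add_mul, map_add]
    rw [rTensor_cons_mul, rTensor_mul_one_tmul, one_tmul_mul_rTensor,
      Algebra.TensorProduct.tmul_mul_tmul, one_mul, cons_mul_cons]
    simp only [tmul_add]
    abel

end Product

/-! ### The antipode as a convolution inverse. -/

section Antipode

variable {α : Type} [QuasiShuffleAlphabet α]

theorem nil_mul_nil : word ([] : List α) * word [] = word [] := one_mul (1 : QSh α)

/-- The left inverse of the identity for convolution, on words. -/
def leftAntipodeWord : List α → QSh α
  | [] => 1
  | a :: w => -∑ i : Fin (w.length + 1),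
      leftAntipodeWord ((a :: w).take i) * word ((a :: w).drop i)
termination_by w => w.length
decreasing_by
  have := i.2
  simp only [List.length_take, List.length_cons]
  omega

/-- The right inverse of the identity for convolution, on words. -/
def rightAntipodeWord : List α → QSh α
  | [] => 1
  | a :: w => -∑ i : Fin (w.length + 1),
      word ((a :: w).take (i + 1)) * rightAntipodeWord ((a :: w).drop (i + 1))
termination_by w => w.length
decreasing_by
  simp only [List.length_drop, List.length_cons]
  omega

/-- The antipode, defined as a left inverse of the identity for convolution. -/
def antipode : QSh α →ₗ[ℚ] QSh α := lin leftAntipodeWord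

theorem mul'_map_dec_word (f g : QSh α →ₗ[ℚ] QSh α) (w : List α) :
    LinearMap.mul' ℚ (QSh α) (TensorProduct.map f g (dec (word w))) =
      ∑ i ∈ Finset.range (w.length + 1), f (word (w.take i)) * g (word (w.drop i)) := by
  simp [dec]

/-- On a nonempty word, the summand with empty right factor is the antipode of the whole word, which
is defined as minus the sum of all the others. -/
theorem mul_antipode_rTensor_dec : LinearMap.mul' ℚ (QSh α) ∘ₗ antipode.rTensor (QSh α) ∘ₗ dec =
    Algebra.linearMap ℚ (QSh α) ∘ₗ counit := by
  refine lin_ext fun w => ?_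
  rw [LinearMap.comp_apply, LinearMap.comp_apply, LinearMap.rTensor, mul'_map_dec_word]
  cases w with
  | nil => simp [antipode, leftAntipodeWord, counit_nil, one_def, nil_mul_nil]
  | cons a w =>
    rw [LinearMap.comp_apply, counit_word_cons, map_zero, List.length_cons, Finset.sum_range_succ,
      ← List.length_cons (a := a), List.take_length, List.drop_length, antipode, lin_word,
      leftAntipodeWord, ← Fin.sum_univ_eq_sum_range
        (fun i => lin leftAntipodeWord (word ((a :: w).take i)) *
          LinearMap.id (R := ℚ) (word ((a :: w).drop i)))]
    simp [← one_def]

theorem mul_lTensor_rightAntipode_dec :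
    LinearMap.mul' ℚ (QSh α) ∘ₗ (lin rightAntipodeWord).lTensor (QSh α) ∘ₗ dec =
    Algebra.linearMap ℚ (QSh α) ∘ₗ counit := by
  refine lin_ext fun w => ?_
  rw [LinearMap.comp_apply, LinearMap.comp_apply, LinearMap.lTensor, mul'_map_dec_word]
  cases w with
  | nil => simp [rightAntipodeWord, counit_nil, one_def, nil_mul_nil]
  | cons a w =>
    rw [LinearMap.comp_apply, counit_word_cons, map_zero, List.length_cons, Finset.sum_range_succ',
      List.take_zero, List.drop_zero, lin_word,
      rightAntipodeWord, ← Fin.sum_univ_eq_sum_range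
        (fun i => LinearMap.id (R := ℚ) (word ((a :: w).take (i + 1))) *
          lin rightAntipodeWord (word ((a :: w).drop (i + 1))))]
    simp [← one_def]

/-- The recursions give a left and a right inverse of the identity separately; they coincide because
convolution is associative. -/
theorem mul_antipode_lTensor_dec : LinearMap.mul' ℚ (QSh α) ∘ₗ antipode.lTensor (QSh α) ∘ₗ dec =
    Algebra.linearMap ℚ (QSh α) ∘ₗ counit := by
  have hl : WithConv.toConv (antipode : QSh α →ₗ[ℚ] QSh α) * WithConv.toConv LinearMap.id = 1 :=
    congrArg WithConv.toConv mul_antipode_rTensor_dec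
  have hr : WithConv.toConv LinearMap.id *
      WithConv.toConv (lin rightAntipodeWord : QSh α →ₗ[ℚ] QSh α) = 1 :=
    congrArg WithConv.toConv mul_lTensor_rightAntipode_dec
  have h := left_inv_eq_right_inv hl hr
  have h' : (antipode : QSh α →ₗ[ℚ] QSh α) = lin rightAntipodeWord := congrArg WithConv.ofConv h
  rw [h']
  exact mul_lTensor_rightAntipode_dec

end Antipode

/-! ### The weight grading of a quasi-shuffle algebra. -/

section Grading

variable {α : Type} [QuasiShuffleAlphabet α] (wt : α → ℕ)

theorem word_mem_grade (w : List α) : word w ∈ grade wt (w.map wt).sum :=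
  Submodule.subset_span ⟨w, rfl, rfl⟩

theorem grade_induction {wt : α → ℕ} {n : ℕ} {p : QSh α → Prop} {x : QSh α} (hx : x ∈ grade wt n)
    (hw : ∀ w : List α, (w.map wt).sum = n → p (word w)) (zero : p 0)
    (add : ∀ x y, p x → p y → p (x + y)) (smul : ∀ (r : ℚ) x, p x → p (r • x)) : p x := by
  induction hx using Submodule.span_induction with
  | mem x hx =>
    obtain ⟨w, hw', rfl⟩ := hx
    exact hw w hw'
  | zero => exact zero
  | add x y _ _ hx hy => exact add x y hx hy
  | smul r x _ hx => exact smul r x hx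

/-- The decomposition of an element into its homogeneous components. -/
def gradeDecompose : QSh α →ₗ[ℚ] DirectSum ℕ fun n => grade wt n :=
  lin fun w => DirectSum.lof ℚ ℕ (fun n => grade wt n) _ ⟨word w, word_mem_grade wt w⟩

theorem isInternal_grade : DirectSum.IsInternal (grade (α := α) wt) := by
  have : DirectSum.Decomposition (grade (α := α) wt) := by
    refine DirectSum.Decomposition.ofLinearMap (grade wt) (gradeDecompose wt) ?_ ?_
    · refine lin_ext fun w => ?_
      simp [gradeDecompose]
    · refine DirectSum.linearMap_ext ℚ fun n => LinearMap.ext fun x => ?_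
      obtain ⟨x, hx⟩ := x
      simp only [LinearMap.comp_apply, LinearMap.id_apply, DirectSum.coeLinearMap_lof]
      induction hx using Submodule.span_induction with
      | mem x hx =>
        obtain ⟨w, rfl, rfl⟩ := hx
        simp [gradeDecompose]
      | zero =>
        rw [map_zero]
        exact (map_zero _).symm
      | add x y hx hy h h' =>
        rw [map_add, h, h', ← map_add]
        rfl
      | smul r x hx h =>
        rw [map_smul, h, ← map_smul]
        rfl
  exact DirectSum.Decomposition.isInternal _

/-- The projection to the homogeneous component of weight `n`. -/
def gradeProj (n : ℕ) : QSh α →ₗ[ℚ] QSh α := lin fun w => if (w.map wt).sum = n then word w else 0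

/-- Membership becomes a linear equation, so compatibility of a linear map with weights can be
tested by commuting it with projections. -/
theorem mem_grade_iff {n : ℕ} {x : QSh α} : x ∈ grade wt n ↔ gradeProj wt n x = x := by
  constructor
  · intro hx
    refine grade_induction (p := fun x => gradeProj wt n x = x) hx (fun w hw => ?_) (by simp)
      (fun x y hx hy => by simp [hx, hy])
      (fun r x hx => by simp [hx])
    simp [gradeProj, hw]
  · intro h
    rw [← h]
    refine word_induction (p := fun x => gradeProj wt n x ∈ grade wt n) (by simp)
      (fun x y hx hy => by simpa using add_mem hx hy)
      (fun r x hx => by simpa using Submodule.smul_mem _ r hx) (fun w => ?_) x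
    simp only [gradeProj, lin_word]
    split_ifs with hw
    · exact Submodule.subset_span ⟨w, hw, rfl⟩
    · exact zero_mem _

theorem cons_mem_grade {wt : α → ℕ} {n : ℕ} (a : α) {x : QSh α} (hx : x ∈ grade wt n) :
    cons a x ∈ grade wt (wt a + n) :=
  grade_induction (p := fun x => cons a x ∈ grade wt (wt a + n)) hx
    (fun w hw => by rw [cons_word]; exact Submodule.subset_span ⟨a :: w, by simp [hw], rfl⟩)
    (by simp) (fun x y hx hy => by simpa using add_mem hx hy)
    (fun r x hx => by simpa using Submodule.smul_mem _ r hx)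

theorem mulWord_mem_grade {wt : α → ℕ} (hwt : ∀ a b c, dia a b = some c → wt c = wt a + wt b) :
    ∀ u v : List α, word u * word v ∈ grade wt ((u.map wt).sum + (v.map wt).sum)
  | [], v => by
    rw [← one_def, one_mul]
    simpa using word_mem_grade wt v
  | a :: u, [] => by
    rw [← one_def, mul_one]
    simpa using word_mem_grade wt (a :: u)
  | a :: u, b :: v => by
    rw [← cons_word, ← cons_word, cons_mul_cons, cons_word, cons_word]
    refine add_mem (add_mem ?_ ?_) ?_
    · have := cons_mem_grade a (mulWord_mem_grade hwt u (b :: v))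
      simpa [add_assoc] using this
    · have := cons_mem_grade b (mulWord_mem_grade hwt (a :: u) v)
      simpa [add_assoc, add_left_comm] using this
    · cases h : dia a b with
      | none => simp [consOpt]
      | some c =>
        have := cons_mem_grade c (mulWord_mem_grade hwt u v)
        rw [hwt a b c h] at this
        simpa [add_assoc, add_left_comm, consOpt] using this
  termination_by u v => u.length + v.length

theorem mul_mem_grade {wt : α → ℕ} (hwt : ∀ a b c, dia a b = some c → wt c = wt a + wt b)
    {m n : ℕ} {x y : QSh α} (hx : x ∈ grade wt m) (hy : y ∈ grade wt n) :
    x * y ∈ grade wt (m + n) := by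
  refine grade_induction (p := fun x => x * y ∈ grade wt (m + n)) hx (fun u hu => ?_) (by simp)
    (fun x x' h h' => ?_) (fun r x h => ?_)
  · refine grade_induction (p := fun y => word u * y ∈ grade wt (m + n)) hy (fun v hv => ?_) (by simp)
      (fun x x' h h' => ?_) (fun r x h => ?_)
    · rw [← hu, ← hv]
      exact mulWord_mem_grade hwt u v
    · rw [mul_add]
      exact add_mem h h'
    · rw [mul_smul_comm]
      exact Submodule.smul_mem _ r h
  · rw [add_mul]
    exact add_mem h h'
  · rw [smul_mul_assoc]
    exact Submodule.smul_mem _ r h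

theorem dec_mem_grade {n : ℕ} {x : QSh α} (hx : x ∈ grade wt n) :
    dec x ∈ ⨆ (i : ℕ) (j : ℕ) (_ : i + j = n),
      LinearMap.range (TensorProduct.mapIncl (grade wt i) (grade wt j)) := by
  refine grade_induction (p := fun x => dec x ∈ ⨆ (i : ℕ) (j : ℕ) (_ : i + j = n),
      LinearMap.range (TensorProduct.mapIncl (grade wt i) (grade wt j))) hx
    (fun w hw => ?_) (by simp) (fun x y hx hy => ?_) (fun r x hx => ?_)
  · simp only [dec, lin_word]
    refine sum_mem fun i _ => ?_
    refine Submodule.mem_iSup_of_mem ((w.take i).map wt).sum <|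
      Submodule.mem_iSup_of_mem ((w.drop i).map wt).sum <| Submodule.mem_iSup_of_mem ?_ ?_
    · rw [← hw, ← List.sum_append, ← List.map_append, List.take_append_drop]
    · exact ⟨⟨_, word_mem_grade wt _⟩ ⊗ₜ ⟨_, word_mem_grade wt _⟩, rfl⟩
  · rw [map_add]
    exact add_mem hx hy
  · rw [map_smul]
    exact Submodule.smul_mem _ r hx

theorem leftAntipodeWord_mem_grade {wt : α → ℕ}
    (hwt : ∀ a b c, dia a b = some c → wt c = wt a + wt b) :
    ∀ w : List α, leftAntipodeWord w ∈ grade wt (w.map wt).sum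
  | [] => by
    rw [leftAntipodeWord]
    exact word_mem_grade wt []
  | a :: w => by
    rw [leftAntipodeWord]
    refine neg_mem (sum_mem fun i _ => ?_)
    have := mul_mem_grade hwt (leftAntipodeWord_mem_grade hwt ((a :: w).take i))
      (word_mem_grade wt ((a :: w).drop i))
    rwa [← List.sum_append, ← List.map_append, List.take_append_drop] at this
  termination_by w => w.length
  decreasing_by
    have := i.2
    simp only [List.length_take, List.length_cons]
    omega

/-- A quasi-shuffle algebra is a graded Hopf algebra if the weight is additive on letters. -/
theorem isGradedHopfAlgebra (hwt : ∀ a b c, dia a b = some c → wt c = wt a + wt b) :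
    IsGradedHopfAlgebra ℚ (antipode : QSh α →ₗ[ℚ] QSh α) (grade wt) where
  coassoc := coassoc_dec
  rTensor_counit_comp_comul := rTensor_counit_dec
  lTensor_counit_comp_comul := lTensor_counit_dec
  counit_one := counit_nil
  counit_mul := counit_mul
  comul_one := dec_one
  comul_mul := dec_mul
  mul_antipode_rTensor_comul := mul_antipode_rTensor_dec
  mul_antipode_lTensor_comul := mul_antipode_lTensor_dec
  isInternal := isInternal_grade wt
  gradedMonoid :=
    { one_mem := word_mem_grade wt []
      mul_mem := fun _ _ _ _ => mul_mem_grade hwt }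
  comul_mem _ _ := dec_mem_grade wt
  counit_eq_zero n x hx hn := by
    refine grade_induction (p := fun x => counit x = 0) hx (fun w hw => ?_) (by simp)
      (fun x y hx hy => by simp [hx, hy]) (fun r x hx => by simp [hx])
    cases w with
    | nil => exact absurd hw.symm hn
    | cons a w => exact counit_word_cons a w
  antipode_mem n x hx := by
    refine grade_induction (p := fun x => antipode x ∈ grade wt n) hx (fun w hw => ?_) (by simp)
      (fun x y hx hy => by simpa using add_mem hx hy)
      (fun r x hx => by simpa using Submodule.smul_mem _ r hx)
    rw [antipode, lin_word, ← hw]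
    exact leftAntipodeWord_mem_grade hwt w

end Grading

/-! ### Appending and deleting last letters. -/

section RightStrip

variable {α : Type}

/-- Appending a letter to all words. -/
def snoc (a : α) : QSh α →ₗ[ℚ] QSh α := lin fun w => word (w ++ [a])

@[simp] theorem snoc_word (a : α) (w : List α) : snoc a (word w) = word (w ++ [a]) := by
  simp [snoc]

theorem snoc_cons (a b : α) (x : QSh α) : snoc a (cons b x) = cons b (snoc a x) := by
  have : snoc a ∘ₗ cons b = cons b ∘ₗ snoc a := lin_ext fun w => by simp
  exact congrArg (fun f => f x) this

theorem lin_ext_snoc {M : Type} [AddCommGroup M] [Module ℚ M] {f g : QSh α →ₗ[ℚ] M}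
    (nil : f (word []) = g (word [])) (snoc : ∀ a w, f (snoc a (word w)) = g (snoc a (word w))) :
    f = g := by
  refine lin_ext fun w => ?_
  rcases List.eq_nil_or_concat w with rfl | ⟨u, a, rfl⟩
  · exact nil
  · have := snoc a u
    rwa [snoc_word, ← List.concat_eq_append] at this

/-- Applying a functional to the right tensor factor. -/
def slice {M : Type} [AddCommGroup M] [Module ℚ M] (f : QSh α →ₗ[ℚ] ℚ) : M ⊗[ℚ] QSh α →ₗ[ℚ] M :=
  (TensorProduct.rid ℚ M).toLinearMap ∘ₗ f.lTensor M

@[simp] theorem slice_tmul {M : Type} [AddCommGroup M] [Module ℚ M] (f : QSh α →ₗ[ℚ] ℚ)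
    (x : M) (y : QSh α) : slice f (x ⊗ₜ[ℚ] y) = f y • x := by
  simp [slice]

theorem slice_lTensor {M : Type} [AddCommGroup M] [Module ℚ M] {β : Type} (f : QSh α →ₗ[ℚ] ℚ)
    (g : QSh β →ₗ[ℚ] QSh α) (t : M ⊗[ℚ] QSh β) : slice f (g.lTensor M t) = slice (f ∘ₗ g) t := by
  simp [slice, LinearMap.lTensor_comp]

theorem slice_rTensor {M N : Type} [AddCommGroup M] [Module ℚ M] [AddCommGroup N] [Module ℚ N]
    (f : QSh α →ₗ[ℚ] ℚ) (g : M →ₗ[ℚ] N) (t : M ⊗[ℚ] QSh α) :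
    slice f (g.rTensor _ t) = g (slice f t) := by
  induction t with
  | zero => simp
  | add x y hx hy => simp only [map_add, hx, hy]
  | tmul x y => simp

/-- The tensor product M ⊗ ℚ⟨α⟩ is the space of finitely supported functions from words to M, and
the slices are the values of such a function. -/
theorem slice_ext {M : Type} [AddCommGroup M] [Module ℚ M] {t : M ⊗[ℚ] QSh α}
    (h : ∀ w, slice (coeff w) t = 0) : t = 0 := by
  classical
  let e : M ⊗[ℚ] QSh α ≃ₗ[ℚ] (List α →₀ M) := TensorProduct.finsuppScalarRight ℚ ℚ M (List α)
  refine e.injective ?_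
  rw [map_zero]
  refine Finsupp.ext fun w => ?_
  exact (TensorProduct.finsuppScalarRight_apply (S := ℚ) (M := M) t w).trans (h w)

theorem coeff_singleton_comp_snoc_of_ne {a b : α} (h : b ≠ a) : coeff [a] ∘ₗ snoc b = 0 := by
  classical
  refine lin_ext fun w => ?_
  cases w <;> simp [coeff_word, h]

theorem coeff_singleton_nil (a : α) : coeff [a] (word []) = 0 := by
  classical
  simp [coeff_word]

variable [QuasiShuffleAlphabet α]

theorem slice_counit_dec (x : QSh α) : slice counit (dec x) = x := by
  have := congrArg (fun f => TensorProduct.rid ℚ _ (f x)) (lTensor_counit_dec (α := α))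
  simpa [slice] using this

theorem dec_snoc (a : α) (x : QSh α) :
    dec (snoc a x) = (snoc a).lTensor (QSh α) (dec x) + snoc a x ⊗ₜ[ℚ] word [] := by
  refine word_induction (p := fun x => dec (snoc a x) =
    (snoc a).lTensor (QSh α) (dec x) + snoc a x ⊗ₜ[ℚ] word []) (by simp) ?_ ?_ (fun w => ?_) x
  · intro x y hx hy
    simp only [map_add, hx, hy, add_tmul]
    abel
  · intro r x hx
    simp only [map_smul, hx, smul_add, smul_tmul']
  · induction w with
    | nil =>
      rw [snoc_word, List.nil_append, ← cons_word, dec_cons, dec_nil]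
      simp [add_comm]
    | cons b w ih =>
      rw [← cons_word, snoc_cons, dec_cons, ih, dec_cons]
      simp only [map_add, LinearMap.rTensor_tmul, LinearMap.lTensor_tmul, snoc_cons]
      rw [← LinearMap.comp_apply, LinearMap.rTensor_comp_lTensor,
        ← LinearMap.lTensor_comp_rTensor, LinearMap.comp_apply]
      abel

/-- Deleting the last letter `a` of words, and mapping all words that do not end in `a` to `0`. -/
def rstrip (a : α) : QSh α →ₗ[ℚ] QSh α := slice (coeff [a]) ∘ₗ dec

theorem coeff_singleton_comp_snoc (a : α) : coeff [a] ∘ₗ snoc a = counit := by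
  classical
  refine lin_ext fun w => ?_
  cases w <;> simp [coeff_word, counit_eq_coeff]

theorem rstrip_nil (a : α) : rstrip a (word []) = 0 := by
  simp [rstrip, dec_nil, coeff_singleton_nil]

theorem rstrip_snoc_self (a : α) (x : QSh α) : rstrip a (snoc a x) = x := by
  rw [rstrip, LinearMap.comp_apply, dec_snoc, map_add, slice_lTensor, slice_tmul,
    coeff_singleton_comp_snoc, coeff_singleton_nil, zero_smul, add_zero, slice_counit_dec]

theorem rstrip_snoc_of_ne {a b : α} (h : b ≠ a) (x : QSh α) : rstrip a (snoc b x) = 0 := by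
  rw [rstrip, LinearMap.comp_apply, dec_snoc, map_add, slice_lTensor, slice_tmul,
    coeff_singleton_comp_snoc_of_ne h, coeff_singleton_nil, zero_smul, add_zero]
  simp [slice]

/-- This is what turns deletion into an induction: a coefficient at a longer word becomes a
coefficient at a shorter one. -/
theorem coeff_append_singleton (w : List α) (a : α) (x : QSh α) :
    coeff (w ++ [a]) x = coeff w (rstrip a x) := by
  classical
  have : coeff (w ++ [a]) = coeff w ∘ₗ rstrip a := by
    refine lin_ext_snoc ?_ fun b u => ?_
    · rw [LinearMap.comp_apply, rstrip_nil]
      simp [coeff_word]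
    · by_cases h : b = a
      · subst h
        rw [LinearMap.comp_apply, rstrip_snoc_self]
        simp [coeff_word]
      · rw [LinearMap.comp_apply, rstrip_snoc_of_ne h]
        simp [coeff_word, h]
  exact congrArg (fun f => f x) this

theorem ext_rstrip {x : QSh α} (h : counit x = 0) (h' : ∀ a, rstrip a x = 0) : x = 0 := by
  refine ext_coeff fun w => ?_
  rcases List.eq_nil_or_concat w with rfl | ⟨u, a, rfl⟩
  · exact h
  · rw [List.concat_eq_append, coeff_append_singleton, h', map_zero]

theorem counit_snoc (a : α) (x : QSh α) : counit (snoc a x) = 0 := by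
  classical
  have : counit ∘ₗ snoc a = 0 := lin_ext fun w => by simp [counit_eq_coeff, coeff_word]
  exact congrArg (fun f => f x) this

/-- The last letter of uv is that of v unless v is empty, and such terms are killed because deletion
kills the empty word. -/
theorem lTensor_rstrip_dec (a : α) (x : QSh α) :
    (rstrip a).lTensor (QSh α) (dec x) = dec (rstrip a x) := by
  have : (rstrip a).lTensor (QSh α) ∘ₗ dec = dec ∘ₗ rstrip a := by
    refine lin_ext_snoc ?_ fun b u => ?_
    · simp [dec_nil, rstrip_nil]
    · rw [LinearMap.comp_apply, dec_snoc, map_add, ← LinearMap.comp_apply,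
        ← LinearMap.lTensor_comp, LinearMap.lTensor_tmul, rstrip_nil, tmul_zero, add_zero,
        LinearMap.comp_apply]
      by_cases h : b = a
      · subst h
        rw [show rstrip b ∘ₗ snoc b = LinearMap.id from LinearMap.ext (rstrip_snoc_self b),
          rstrip_snoc_self, LinearMap.lTensor_id, LinearMap.id_apply]
      · have h0 : rstrip a ∘ₗ snoc b = 0 := LinearMap.ext fun x => rstrip_snoc_of_ne h x
        rw [h0, rstrip_snoc_of_ne h, LinearMap.lTensor_zero, map_zero]
        rfl
  exact congrArg (fun f => f x) this

theorem rstrip_cons (a c : α) (x : QSh α) :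
    rstrip c (cons a x) = cons a (rstrip c x) + coeff [c] (cons a x) • word [] := by
  rw [rstrip, LinearMap.comp_apply, dec_cons, map_add, slice_rTensor, slice_tmul,
    LinearMap.comp_apply]

theorem coeff_singleton_cons [DecidableEq α] (a c : α) (x : QSh α) :
    coeff [c] (cons a x) = if a = c then counit x else 0 := by
  have : coeff [c] ∘ₗ cons a = if a = c then counit else 0 := by
    refine lin_ext fun w => ?_
    split_ifs with h <;> simp [coeff_word, counit_eq_coeff, h]
  have h := congrArg (fun f => f x) this
  simp only [LinearMap.comp_apply] at h
  rw [h]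
  split_ifs <;> rfl

/-! ### The product rule for deletion of last letters. -/

section Product

variable {ι : Type} (i : ι → α) (s : Finset (ι × ι)) (c : α)

/-- A one-letter word c arises from c in one factor and a constant in the other, or by merging two
single letters with product c. The finite set `s` lists the factorizations of c through an injective
labelling, so each is counted once. -/
theorem coeff_singleton_mul (hi : Function.Injective i)
    (hs : ∀ a b, dia a b = some c ↔ ∃ p ∈ s, a = i p.1 ∧ b = i p.2) (x y : QSh α) :
    coeff [c] (x * y) = coeff [c] x * counit y + counit x * coeff [c] y +
      ∑ p ∈ s, coeff [i p.1] x * coeff [i p.2] y := by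
  classical
  have h1 : counit (1 : QSh α) = 1 := counit_nil
  have h2 : ∀ a : α, coeff [a] 1 = 0 := coeff_singleton_nil
  induction x, y using mul_induction with
  | zero_left y => simp
  | add_left x x' y h h' =>
    simp only [add_mul, map_add, h, h', Finset.sum_add_distrib]
    ring
  | smul_left r x y h =>
    simp only [smul_mul_assoc, map_smul, h, smul_eq_mul, mul_add, Finset.mul_sum, mul_assoc]
  | zero_right x => simp
  | add_right x y y' h h' =>
    simp only [mul_add, map_add, h, h', Finset.sum_add_distrib]
    ring
  | smul_right r x y h =>
    simp only [mul_smul_comm, map_smul, h, smul_eq_mul, mul_add, Finset.mul_sum, mul_left_comm r]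
  | nil_left y => simp [h1, h2]
  | nil_right x => simp [h1, h2]
  | cons_cons a b x y =>
    simp only [cons_mul_cons, map_add, coeff_singleton_cons, counit_mul, counit_cons, mul_zero,
      zero_mul, ite_self, zero_add]
    have h3 : coeff [c] (consOpt (dia a b) (x * y)) =
        if dia a b = some c then counit x * counit y else 0 := by
      cases h : dia a b with
      | none => simp [consOpt]
      | some d => simp [consOpt, coeff_singleton_cons, counit_mul]
    rw [h3]
    split_ifs with h
    · obtain ⟨⟨j, k⟩, hp, rfl, rfl⟩ := (hs a b).1 h
      rw [Finset.sum_eq_single_of_mem (j, k) hp]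
      · simp
      · rintro ⟨j', k'⟩ _ hne
        simp only [hi.eq_iff]
        by_cases h4 : j = j'
        · have : k ≠ k' := fun h5 => hne (by rw [h4, h5])
          simp [this]
        · simp [h4]
    · refine (Finset.sum_eq_zero ?_).symm
      rintro ⟨j, k⟩ hp
      have : ¬ (a = i j ∧ b = i k) := fun h5 => h ((hs a b).2 ⟨_, hp, h5⟩)
      by_cases h4 : a = i j
      · have : b ≠ i k := fun h5 => this ⟨h4, h5⟩
        simp [this]
      · simp [h4]

/-- The quasi-derivation rule for the deletion of last letters. -/
theorem rstrip_mul (hi : Function.Injective i)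
    (hs : ∀ a b, dia a b = some c ↔ ∃ p ∈ s, a = i p.1 ∧ b = i p.2) (x y : QSh α) :
    rstrip c (x * y) = rstrip c x * y + x * rstrip c y +
      ∑ p ∈ s, rstrip (i p.1) x * rstrip (i p.2) y := by
  -- Deletion is the slice of `dec` along the functional `coeff [c]`. Since `dec` is multiplicative,
  -- the product rule of this functional passes to tensors and gives that of `rstrip c`.
  have key : ∀ t t' : QSh α ⊗[ℚ] QSh α, slice (coeff [c]) (t * t') =
      slice (coeff [c]) t * slice counit t' + slice counit t * slice (coeff [c]) t' +
        ∑ p ∈ s, slice (coeff [i p.1]) t * slice (coeff [i p.2]) t' := by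
    intro t t'
    induction t with
    | zero => simp
    | add x y hx hy =>
      simp only [add_mul, map_add, hx, hy, Finset.sum_add_distrib]
      abel
    | tmul x y =>
      induction t' with
      | zero => simp
      | add x y hx hy =>
        simp only [mul_add, map_add, hx, hy, Finset.sum_add_distrib]
        abel
      | tmul x' y' =>
        simp only [Algebra.TensorProduct.tmul_mul_tmul, slice_tmul,
          coeff_singleton_mul i s c hi hs, smul_mul_smul_comm, add_smul, Finset.sum_smul]
  have h := key (dec x) (dec y)
  rw [← dec_mul, slice_counit_dec, slice_counit_dec] at h
  exact h

end Product

theorem counit_gradeProj (wt : α → ℕ) (n : ℕ) (x : QSh α) :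
    counit (gradeProj wt n x) = if n = 0 then counit x else 0 := by
  classical
  have : counit ∘ₗ gradeProj wt n = if n = 0 then counit else 0 := by
    refine lin_ext fun w => ?_
    cases w with
    | nil =>
      rcases eq_or_ne n 0 with rfl | h
      · simp [gradeProj]
      · simp [gradeProj, h, h.symm]
    | cons a w =>
      simp only [LinearMap.comp_apply, gradeProj, lin_word]
      split_ifs <;> simp [counit_word_cons]
  have h := congrArg (fun f => f x) this
  simp only [LinearMap.comp_apply] at h
  rw [h]
  split_ifs <;> rfl

theorem rstrip_gradeProj_add (wt : α → ℕ) (a : α) (n : ℕ) (x : QSh α) :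
    rstrip a (gradeProj wt (n + wt a) x) = gradeProj wt n (rstrip a x) := by
  have : rstrip a ∘ₗ gradeProj wt (n + wt a) = gradeProj wt n ∘ₗ rstrip a := by
    refine lin_ext_snoc ?_ fun b u => ?_
    · simp only [LinearMap.comp_apply, gradeProj, lin_word, rstrip_nil]
      split_ifs <;> simp [rstrip_nil]
    · simp only [LinearMap.comp_apply, snoc_word, gradeProj, lin_word]
      by_cases h : b = a
      · subst h
        rw [← snoc_word, rstrip_snoc_self, lin_word]
        simp only [List.map_append, List.sum_append, List.map_cons, List.map_nil, List.sum_cons,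
          List.sum_nil, add_zero, add_left_inj]
        split_ifs
        · rw [rstrip_snoc_self]
        · simp
      · rw [← snoc_word, rstrip_snoc_of_ne h]
        split_ifs <;> simp [rstrip_snoc_of_ne h, -snoc_word]
  exact congrArg (fun f => f x) this

theorem rstrip_gradeProj_of_lt {wt : α → ℕ} {a : α} {n : ℕ} (hn : n < wt a) (x : QSh α) :
    rstrip a (gradeProj wt n x) = 0 := by
  have : rstrip a ∘ₗ gradeProj wt n = 0 := by
    refine lin_ext_snoc ?_ fun b u => ?_
    · simp only [LinearMap.comp_apply, gradeProj, lin_word]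
      split_ifs <;> simp [rstrip_nil]
    · simp only [LinearMap.comp_apply, snoc_word, gradeProj, lin_word]
      by_cases h : b = a
      · subst h
        rw [if_neg (by simp; omega)]
        simp
      · rw [← snoc_word]
        split_ifs <;> simp [rstrip_snoc_of_ne h, -snoc_word]
  exact congrArg (fun f => f x) this

end RightStrip

end

end QSh

noncomputable section

open QSh QuasiShuffleAlphabet TensorProduct

theorem lTensor_rTensor_comm {M M' N N' : Type} [AddCommGroup M] [Module ℚ M] [AddCommGroup M']
    [Module ℚ M'] [AddCommGroup N] [Module ℚ N] [AddCommGroup N'] [Module ℚ N']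
    (f : M →ₗ[ℚ] M') (g : N →ₗ[ℚ] N') (t : M ⊗[ℚ] N) :
    g.lTensor M' (f.rTensor N t) = f.rTensor N' (g.lTensor M t) := by
  rw [LinearMap.lTensor, LinearMap.map_rTensor, LinearMap.rTensor, LinearMap.map_lTensor]
  simp

/-! ## The derivation of `ℚ⟨Y^bi⟩` lowering the second indices -/

/-- The letter `y_{k,m-1}` for `y_{k,m}`. -/
def YLetter.pred (a : YLetter) : YLetter := ⟨a.k, a.m - 1⟩

/-- The derivation `derivY` on words. -/
def derivYWord : List YLetter → QY
  | [] => 0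
  | a :: w => (a.m : ℚ) • word (a.pred :: w) + cons a (derivYWord w)

/-- The derivation of `ℚ⟨Y^bi⟩` with `y_{k,m} ↦ m y_{k,m-1}`, acting letterwise. -/
def derivY : QY →ₗ[ℚ] QY := lin derivYWord

theorem derivY_nil : derivY (word []) = 0 := by simp [derivY, derivYWord]

theorem derivY_one : derivY 1 = 0 := derivY_nil

theorem derivY_cons (a : YLetter) (x : QY) :
    derivY (cons a x) = (a.m : ℚ) • cons a.pred x + cons a (derivY x) := by
  have : derivY ∘ₗ cons a = (a.m : ℚ) • cons a.pred + cons a ∘ₗ derivY :=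
    lin_ext fun w => by simp [derivY, derivYWord]
  exact congrArg (fun f => f x) this

theorem derivY_snoc (a : YLetter) (x : QY) :
    derivY (snoc a x) = snoc a (derivY x) + (a.m : ℚ) • snoc a.pred x := by
  refine word_induction (p := fun x => derivY (snoc a x) =
    snoc a (derivY x) + (a.m : ℚ) • snoc a.pred x) (by simp) ?_ ?_ (fun w => ?_) x
  · intro x y hx hy
    simp only [map_add, hx, hy, smul_add]
    abel
  · intro r x hx
    simp only [map_smul, hx, smul_add, smul_comm r]
  · induction w with
    | nil =>
      rw [snoc_word, List.nil_append, ← cons_word, derivY_cons, derivY_nil]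
      simp
    | cons b w ih =>
      rw [← cons_word, snoc_cons, derivY_cons, ih, derivY_cons]
      simp only [map_add, map_smul, snoc_cons]
      abel

/-- The letter product adds the second indices, and lowering either one gives the same letter; the
multiplicities add up as m + n. -/
theorem derivY_consOpt_dia (a b : YLetter) (x : QY) :
    derivY (consOpt (dia a b) x) = (a.m : ℚ) • consOpt (dia a.pred b) x +
      (b.m : ℚ) • consOpt (dia a b.pred) x + consOpt (dia a b) (derivY x) := by
  -- The truncated subtraction is wrong only for index 0, where the coefficient vanishes.
  have h1 : (a.m : ℚ) • cons (⟨a.k + b.k, a.m - 1 + b.m⟩ : YLetter) x =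
      (a.m : ℚ) • cons (⟨a.k + b.k, a.m + b.m - 1⟩ : YLetter) x := by
    rcases Nat.eq_zero_or_pos a.m with h | h
    · simp [h]
    · rw [Nat.sub_add_comm h]
  have h2 : (b.m : ℚ) • cons (⟨a.k + b.k, a.m + (b.m - 1)⟩ : YLetter) x =
      (b.m : ℚ) • cons (⟨a.k + b.k, a.m + b.m - 1⟩ : YLetter) x := by
    rcases Nat.eq_zero_or_pos b.m with h | h
    · simp [h]
    · rw [Nat.add_sub_assoc h]
  change derivY (cons (⟨a.k + b.k, a.m + b.m⟩ : YLetter) x) =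
    (a.m : ℚ) • cons (⟨a.k + b.k, a.m - 1 + b.m⟩ : YLetter) x +
      (b.m : ℚ) • cons (⟨a.k + b.k, a.m + (b.m - 1)⟩ : YLetter) x +
      cons (⟨a.k + b.k, a.m + b.m⟩ : YLetter) (derivY x)
  rw [h1, h2, derivY_cons, ← add_smul]
  simp [YLetter.pred]

theorem derivY_mul (x y : QY) : derivY (x * y) = derivY x * y + x * derivY y := by
  induction x, y using mul_induction with
  | zero_left y => simp
  | add_left x x' y h h' => simp only [add_mul, map_add, h, h']; abel
  | smul_left r x y h => simp only [smul_mul_assoc, map_smul, h, smul_add]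
  | zero_right x => simp
  | add_right x y y' h h' => simp only [mul_add, map_add, h, h']; abel
  | smul_right r x y h => simp only [mul_smul_comm, map_smul, h, smul_add]
  | nil_left y => simp [derivY_one]
  | nil_right x => simp [derivY_one]
  | cons_cons a b x y h1 h2 h3 =>
    simp only [cons_mul_cons, map_add, derivY_cons, derivY_consOpt_dia, h1, h2, h3, add_mul,
      mul_add, smul_mul_assoc, mul_smul_comm, map_smul, smul_add]
    abel

/-- A map acting on one letter at a time acts either left or right of the cut, so it is a
coderivation. -/
theorem dec_derivY (x : QY) :
    dec (derivY x) = derivY.rTensor QY (dec x) + derivY.lTensor QY (dec x) := by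
  refine word_induction (p := fun x => dec (derivY x) =
    derivY.rTensor QY (dec x) + derivY.lTensor QY (dec x)) (by simp) ?_ ?_ (fun w => ?_) x
  · intro x y hx hy
    simp only [map_add, hx, hy]
    abel
  · intro r x hx
    simp only [map_smul, hx, smul_add]
  · induction w with
    | nil => simp [dec_nil, derivY_nil]
    | cons a w ih =>
      have e : derivY ∘ₗ cons a = (a.m : ℚ) • cons a.pred + cons a ∘ₗ derivY :=
        LinearMap.ext fun x => derivY_cons a x
      rw [← cons_word, derivY_cons, map_add, map_smul, dec_cons, dec_cons, dec_cons, ih]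
      simp only [map_add, LinearMap.rTensor_tmul, LinearMap.lTensor_tmul, derivY_nil, zero_tmul,
        derivY_cons, tmul_add, tmul_smul, smul_add]
      rw [← LinearMap.rTensor_comp_apply QY derivY, e, lTensor_rTensor_comm,
        LinearMap.rTensor_add, LinearMap.rTensor_smul, LinearMap.rTensor_comp]
      simp only [LinearMap.add_apply, LinearMap.smul_apply, LinearMap.comp_apply]
      abel

/-- The two operators commute except where `derivY` hits a last letter y_{k,m+1} and turns it into
(m+1) y_{k,m}. The formula recovers deletion of y_{k,m+1} from `derivY` and deletion of y_{k,m}. -/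
theorem rstrip_derivY (k : ℕ+) (m : ℕ) (x : QY) : rstrip ⟨k, m⟩ (derivY x) =
    derivY (rstrip ⟨k, m⟩ x) + (m + 1 : ℚ) • rstrip ⟨k, m + 1⟩ x := by
  have : rstrip ⟨k, m⟩ ∘ₗ derivY = derivY ∘ₗ rstrip ⟨k, m⟩ +
      (m + 1 : ℚ) • rstrip (⟨k, m + 1⟩ : YLetter) := by
    refine lin_ext_snoc ?_ fun a w => ?_
    · simp [derivY_nil, rstrip_nil]
    · simp only [LinearMap.comp_apply, LinearMap.add_apply, LinearMap.smul_apply, derivY_snoc,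
        map_add, map_smul]
      by_cases h1 : a = ⟨k, m⟩
      · subst h1
        rw [rstrip_snoc_self, rstrip_snoc_self,
          rstrip_snoc_of_ne (show (⟨k, m⟩ : YLetter) ≠ ⟨k, m + 1⟩ by simp)]
        congr 1
        rcases Nat.eq_zero_or_pos m with h | h
        · simp [h, -snoc_word]
        · rw [rstrip_snoc_of_ne]
          · simp
          · simp only [YLetter.pred, ne_eq, YLetter.mk.injEq, true_and]
            omega
      · rw [rstrip_snoc_of_ne h1, rstrip_snoc_of_ne h1, map_zero, zero_add, zero_add]
        by_cases h2 : a = ⟨k, m + 1⟩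
        · subst h2
          rw [rstrip_snoc_self, show YLetter.pred ⟨k, m + 1⟩ = ⟨k, m⟩ from rfl, rstrip_snoc_self]
          simp
        · rw [rstrip_snoc_of_ne h2, smul_zero]
          rcases Nat.eq_zero_or_pos a.m with h | h
          · simp [h]
          · rw [rstrip_snoc_of_ne, smul_zero]
            rintro h3
            apply h2
            obtain ⟨k', m'⟩ := a
            simp only [YLetter.pred, YLetter.mk.injEq] at h3 h ⊢
            exact ⟨h3.1, by omega⟩
  exact congrArg (fun f => f x) this

theorem YLetter.wt_pos (a : YLetter) : 0 < a.wt := by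
  have := a.k.pos
  simp only [YLetter.wt]
  omega

theorem derivYWord_mem_grade : ∀ (w : List YLetter) (n : ℕ), (w.map YLetter.wt).sum = n + 1 →
    derivYWord w ∈ QSh.grade YLetter.wt n
  | [], n, _ => zero_mem _
  | a :: w, n, h => by
    rw [derivYWord]
    simp only [List.map_cons, List.sum_cons] at h
    refine add_mem ?_ ?_
    · rcases Nat.eq_zero_or_pos a.m with hm | hm
      · simp [hm]
      · refine Submodule.smul_mem _ _ (Submodule.subset_span ⟨_, ?_, rfl⟩)
        simp only [YLetter.wt] at h
        simp only [Set.mem_ofPred_eq, List.map_cons, List.sum_cons, YLetter.pred, YLetter.wt]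
        omega
    -- A nonempty tail has weight at least 1, hence `a.wt ≤ n` and the subtraction `n - a.wt` is
    -- exact.
    · cases w with
      | nil => simp [derivYWord]
      | cons b w =>
        have hb := b.wt_pos
        simp only [List.map_cons, List.sum_cons] at h
        have := cons_mem_grade a (derivYWord_mem_grade (b :: w) (n - a.wt) (by
          simp only [List.map_cons, List.sum_cons]
          omega))
        rwa [show a.wt + (n - a.wt) = n by omega] at this

theorem gradeProj_of_mem_of_ne {α : Type} [QuasiShuffleAlphabet α] {wt : α → ℕ} {m n : ℕ}
    (h : m ≠ n) {x : QSh α} (hx : x ∈ QSh.grade wt m) : gradeProj wt n x = 0 := by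
  refine grade_induction (p := fun x => gradeProj wt n x = 0) hx (fun w hw => ?_) (by simp)
    (fun x y hx hy => by simp [hx, hy]) (fun r x hx => by simp [hx])
  simp [gradeProj, hw, h]

theorem derivY_gradeProj_succ (n : ℕ) (x : QY) :
    derivY (gradeProj YLetter.wt (n + 1) x) = gradeProj YLetter.wt n (derivY x) := by
  have : derivY ∘ₗ gradeProj YLetter.wt (n + 1) = gradeProj YLetter.wt n ∘ₗ derivY := by
    refine lin_ext fun w => ?_
    have e : derivY (word w) = derivYWord w := by simp [derivY]
    simp only [LinearMap.comp_apply, e]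
    rw [gradeProj, lin_word]
    split_ifs with h
    · rw [e, (mem_grade_iff _).1 (derivYWord_mem_grade w n h)]
    · rw [map_zero]
      rcases h' : (w.map YLetter.wt).sum with _ | m
      · cases w with
        | nil => simp [derivYWord]
        | cons a w =>
          have := a.wt_pos
          simp only [List.map_cons, List.sum_cons] at h'
          omega
      · rw [gradeProj_of_mem_of_ne (by omega) (derivYWord_mem_grade w m h')]
  exact congrArg (fun f => f x) this

theorem derivY_gradeProj_zero (x : QY) : derivY (gradeProj YLetter.wt 0 x) = 0 := by
  have : derivY ∘ₗ gradeProj YLetter.wt 0 = 0 := by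
    refine lin_ext fun w => ?_
    cases w with
    | nil => simp [gradeProj, derivY_nil]
    | cons a w =>
      have := a.wt_pos
      simp only [LinearMap.comp_apply, gradeProj, lin_word]
      rw [if_neg]
      · simp
      · simp only [List.map_cons, List.sum_cons]
        omega
  exact congrArg (fun f => f x) this

/-! ## Deletion of last letters in the two algebras -/

/-- The letter `b_k` for `k ≥ 1`. -/
def bPos (k : ℕ+) : BLetter := ⟨k⟩

/-- The letter `y_{k,0}`. -/
def yZero (k : ℕ+) : YLetter := ⟨k, 0⟩

/-- The pairs of positive integers with sum `k`. -/
def pnatPairs (k : ℕ+) : Finset (ℕ+ × ℕ+) :=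
  (Finset.Iio k ×ˢ Finset.Iio k).filter fun p => p.1 + p.2 = k

theorem mem_pnatPairs {k : ℕ+} {p : ℕ+ × ℕ+} : p ∈ pnatPairs k ↔ p.1 + p.2 = k := by
  simp only [pnatPairs, Finset.mem_filter, Finset.mem_product, Finset.mem_Iio, and_iff_right_iff_imp]
  rintro rfl
  exact ⟨PNat.lt_add_right _ _, PNat.lt_add_left _ _⟩

theorem bPos_injective : Function.Injective bPos := fun k l h => by
  simpa [bPos] using h

theorem yZero_injective : Function.Injective yZero := fun k l h => by
  simpa [yZero] using h

theorem bPos_ne_b0 (k : ℕ+) : bPos k ≠ b0 := by simp [bPos, b0]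

theorem eq_b0_or_bPos (a : BLetter) : a = b0 ∨ ∃ k, a = bPos k := by
  obtain ⟨s⟩ := a
  rcases Nat.eq_zero_or_pos s with h | h
  · exact Or.inl (by rw [h, b0])
  · exact Or.inr ⟨⟨s, h⟩, rfl⟩

/-- The letter b_0 is not a product of two letters, so the set of factorizations is empty and a true
derivation remains. -/
theorem rstrip_b0_mul (x y : QB) : rstrip b0 (x * y) = rstrip b0 x * y + x * rstrip b0 y := by
  have := rstrip_mul (fun _ : Unit => b0) ∅ b0 (fun _ _ _ => rfl) (fun a b => by
    simp only [Finset.notMem_empty, false_and, exists_false, iff_false]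
    change ¬ (if 1 ≤ a.s ∧ 1 ≤ b.s then some (⟨a.s + b.s⟩ : BLetter) else none) = some b0
    split_ifs with h
    · simp only [b0, Option.some.injEq, BLetter.mk.injEq]
      omega
    · simp) x y
  simpa using this

theorem rstrip_bPos_mul (k : ℕ+) (x y : QB) : rstrip (bPos k) (x * y) =
    rstrip (bPos k) x * y + x * rstrip (bPos k) y +
      ∑ p ∈ pnatPairs k, rstrip (bPos p.1) x * rstrip (bPos p.2) y := by
  refine rstrip_mul bPos (pnatPairs k) (bPos k) bPos_injective (fun a b => ?_) x y
  change (if 1 ≤ a.s ∧ 1 ≤ b.s then some (⟨a.s + b.s⟩ : BLetter) else none) = some (bPos k) ↔ _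
  constructor
  · intro h
    split_ifs at h with h1
    refine ⟨(⟨a.s, h1.1⟩, ⟨b.s, h1.2⟩), ?_, rfl, rfl⟩
    rw [mem_pnatPairs]
    simp only [Option.some.injEq, bPos, BLetter.mk.injEq] at h
    exact PNat.eq h
  · rintro ⟨p, hp, rfl, rfl⟩
    rw [mem_pnatPairs] at hp
    subst hp
    rw [if_pos ⟨p.1.pos, p.2.pos⟩]
    rfl

/-- Second indices are nonnegative and add up, so y_{k,0} factors only as y_{i,0} ⋄ y_{j,0} with i +
j = k. The rule thus matches that of `rstrip_bPos_mul`. -/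
theorem rstrip_yZero_mul (k : ℕ+) (x y : QY) : rstrip (yZero k) (x * y) =
    rstrip (yZero k) x * y + x * rstrip (yZero k) y +
      ∑ p ∈ pnatPairs k, rstrip (yZero p.1) x * rstrip (yZero p.2) y := by
  refine rstrip_mul yZero (pnatPairs k) (yZero k) yZero_injective (fun a b => ?_) x y
  change some (⟨a.k + b.k, a.m + b.m⟩ : YLetter) = some (yZero k) ↔ _
  obtain ⟨i, m⟩ := a
  obtain ⟨j, n⟩ := b
  simp only [Option.some.injEq, yZero, YLetter.mk.injEq, Prod.exists, mem_pnatPairs]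
  constructor
  · rintro ⟨h, h'⟩
    exact ⟨i, j, h, ⟨rfl, by omega⟩, ⟨rfl, by omega⟩⟩
  · rintro ⟨i', j', h, ⟨rfl, rfl⟩, ⟨rfl, rfl⟩⟩
    exact ⟨h, rfl⟩

theorem ext_rstrip_b {x : QB} (h : counit x = 0) (h0 : rstrip b0 x = 0)
    (h' : ∀ k, rstrip (bPos k) x = 0) : x = 0 :=
  ext_rstrip h fun a => by
    rcases eq_b0_or_bPos a with rfl | ⟨k, rfl⟩
    · exact h0
    · exact h' k

/-- Induction over words in the letters `b_s` from the right. -/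
theorem bWord_induction {p : List BLetter → Prop} (nil : p []) (b0 : ∀ w, p w → p (w ++ [b0]))
    (bPos : ∀ w k, p w → p (w ++ [bPos k])) (w : List BLetter) : p w := by
  induction w using List.reverseRecOn with
  | nil => exact nil
  | append_singleton w a ih =>
    rcases eq_b0_or_bPos a with rfl | ⟨k, rfl⟩
    · exact b0 w ih
    · exact bPos w k ih

/-! ## Regularization and the deletion of letters -/

theorem regT_C (x : QB0) : regT (Polynomial.C x) = x := Polynomial.aeval_C _ _

theorem reg_regT (p : Polynomial QB0) : reg (regT p) = p.eval 0 := by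
  change Polynomial.aeval (0 : QB0) ((AlgEquiv.ofBijective regT regT_bijective).symm
    ((AlgEquiv.ofBijective regT regT_bijective) p)) = _
  rw [AlgEquiv.symm_apply_apply, Polynomial.coe_aeval_eq_eval]

theorem reg_coe (x : QB0) : reg (x : QB) = x := by
  rw [← regT_C, reg_regT, Polynomial.eval_C]

theorem reg_b0 : reg (word [b0]) = 0 := by
  have : regT Polynomial.X = word [b0] := Polynomial.aeval_X _
  rw [← this, reg_regT, Polynomial.eval_X]

/-- Surjectivity of `regT` says that ℚ⟨B⟩ is generated as an algebra by ℚ⟨B⟩⁰ and b_0, so maps with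
product rules are determined there. -/
theorem QB_induction {p : QB → Prop} (coe : ∀ x : QB0, p x) (b0 : p (word [b0]))
    (add : ∀ x y, p x → p y → p (x + y)) (mul : ∀ x y, p x → p y → p (x * y)) (x : QB) : p x := by
  obtain ⟨q, rfl⟩ := regT_bijective.surjective x
  induction q using Polynomial.induction_on with
  | C a =>
    rw [regT_C]
    exact coe a
  | add q r hq hr =>
    rw [map_add]
    exact add _ _ hq hr
  | monomial n a h =>
    rw [pow_succ, ← mul_assoc, map_mul]
    refine mul _ _ h ?_
    rw [show regT Polynomial.X = word [_root_.b0] from Polynomial.aeval_X _]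
    exact b0

theorem strip_rstrip (a : BLetter) (x : QB) : strip (rstrip a x) = rstrip a (strip x) := by
  have : strip ∘ₗ rstrip a = rstrip a ∘ₗ strip := by
    refine lin_ext fun w => ?_
    cases w with
    | nil => simp [rstrip_nil, strip_nil]
    | cons c w =>
      simp only [LinearMap.comp_apply]
      rw [← cons_word, rstrip_cons, map_add, strip_cons, strip_cons, map_smul, strip_nil,
        smul_zero, add_zero]
      split_ifs <;> simp
  exact congrArg (fun f => f x) this

theorem rstrip_mem_QB0 (a : BLetter) {x : QB} (hx : x ∈ QB0) : rstrip a x ∈ QB0 := by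
  rw [mem_QB0_iff] at *
  rw [strip_rstrip, hx, map_zero]

theorem rstrip_word_singleton_self {α : Type} [QuasiShuffleAlphabet α] (a : α) :
    rstrip a (word [a]) = 1 := by
  have := rstrip_snoc_self a (word [])
  rwa [snoc_word] at this

theorem rstrip_word_singleton_of_ne {α : Type} [QuasiShuffleAlphabet α] {a b : α} (h : b ≠ a) :
    rstrip a (word [b]) = 0 := by
  have := rstrip_snoc_of_ne h (word [])
  rwa [snoc_word] at this

theorem reg_of_mem {x : QB} (hx : x ∈ QB0) : (reg x : QB) = x :=
  congrArg Subtype.val (reg_coe ⟨x, hx⟩)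

/-- Both compositions obey the same product rule because `reg` is multiplicative, and they agree on
the generators. The index k varies in the induction because the rule involves smaller indices. -/
theorem rstrip_bPos_reg (k : ℕ+) (x : QB) :
    rstrip (bPos k) (reg x : QB) = reg (rstrip (bPos k) x) := by
  induction x using QB_induction generalizing k with
  | coe x => rw [reg_coe, reg_of_mem (rstrip_mem_QB0 _ x.2)]
  | b0 => simp [reg_b0, rstrip_word_singleton_of_ne (bPos_ne_b0 k).symm]
  | add x y hx hy => simp [hx, hy]
  | mul x y hx hy =>
    rw [map_mul, rstrip_bPos_mul, Subalgebra.coe_mul, rstrip_bPos_mul]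
    simp [hx, hy]

/-- Deletion of b_0 on the right and on the left are derivations that both send b_0 to 1. Their
difference kills b_0 and preserves ℚ⟨B⟩⁰, hence commutes with `reg`; on the image of `reg` the left
deletion vanishes. -/
theorem rstrip_b0_reg (x : QB) :
    rstrip b0 (reg x : QB) = reg (rstrip b0 x) - reg (strip x) := by
  induction x using QB_induction with
  | coe x =>
    rw [reg_coe, reg_of_mem (rstrip_mem_QB0 _ x.2), (mem_QB0_iff _).1 x.2]
    simp
  | b0 => simp [reg_b0, rstrip_word_singleton_self, strip_b0]
  | add x y hx hy =>
    simp only [map_add, Subalgebra.coe_add, hx, hy]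
    abel
  | mul x y hx hy =>
    rw [map_mul, Subalgebra.coe_mul, rstrip_b0_mul, hx, hy, rstrip_b0_mul, strip_mul]
    simp only [map_add, map_mul, Subalgebra.coe_add, Subalgebra.coe_mul]
    ring

theorem rTensor_strip_dec (x : QB) : strip.rTensor QB (dec x) = dec (strip x) := by
  have : strip.rTensor QB ∘ₗ dec = dec ∘ₗ strip := by
    refine lin_ext fun w => ?_
    cases w with
    | nil => simp [dec_nil, strip_nil]
    | cons a w =>
      simp only [LinearMap.comp_apply]
      rw [← cons_word, dec_cons, map_add, strip_cons, LinearMap.rTensor_tmul, strip_nil, zero_tmul,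
        add_zero, ← LinearMap.comp_apply, ← LinearMap.rTensor_comp]
      split_ifs with h
      · rw [show strip ∘ₗ cons a = LinearMap.id from LinearMap.ext fun x => by
          rw [LinearMap.comp_apply, strip_cons, if_pos h, LinearMap.id_apply]]
        simp
      · rw [show strip ∘ₗ cons a = 0 from LinearMap.ext fun x => by
          rw [LinearMap.comp_apply, strip_cons, if_neg h, LinearMap.zero_apply]]
        simp
  exact congrArg (fun f => f x) this

/-- On a word w, both sides are the sum of u ⊗ v over the factorizations w = u b_0 v. -/
theorem lTensor_strip_dec (x : QB) : strip.lTensor QB (dec x) = (rstrip b0).rTensor QB (dec x) := by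
  classical
  have : strip.lTensor QB ∘ₗ dec = (rstrip b0).rTensor QB ∘ₗ dec := by
    refine lin_ext fun w => ?_
    induction w with
    | nil => simp [dec_nil, strip_nil, rstrip_nil]
    | cons a w ih =>
      simp only [LinearMap.comp_apply] at ih ⊢
      have e : (rstrip b0 ∘ₗ cons a : QB →ₗ[ℚ] QB) = cons a ∘ₗ rstrip b0 +
          (LinearMap.toSpanSingleton ℚ QB (word []) ∘ₗ (coeff [b0] ∘ₗ cons a)) :=
        LinearMap.ext fun x => by simp [rstrip_cons]
      have e2 : (coeff [b0] ∘ₗ cons a : QB →ₗ[ℚ] ℚ) = if a.s = 0 then counit else 0 := by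
        refine LinearMap.ext fun x => ?_
        rw [LinearMap.comp_apply, coeff_singleton_cons]
        have : a = b0 ↔ a.s = 0 := by
          cases a
          simp [b0]
        simp only [this]
        split_ifs <;> rfl
      have e3 := congrArg (fun f => f (word w)) (rTensor_counit_dec (α := BLetter))
      simp only [LinearMap.comp_apply, mk_apply] at e3
      rw [← cons_word, dec_cons, map_add, map_add, lTensor_rTensor_comm, ih,
        ← LinearMap.rTensor_comp_apply QB (rstrip b0), e,
        LinearMap.rTensor_add, LinearMap.add_apply, LinearMap.rTensor_comp_apply,
        LinearMap.rTensor_comp_apply, LinearMap.lTensor_tmul,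
        LinearMap.rTensor_tmul, rstrip_nil, zero_tmul, add_zero, strip_cons, e2]
      split_ifs with h
      · rw [e3]
        simp
      · simp
  exact congrArg (fun f => f x) this

/-- The regularization as a linear endomorphism of `ℚ⟨B⟩`. -/
def regQB : QB →ₗ[ℚ] QB := QB0.val.toLinearMap ∘ₗ reg.toLinearMap

theorem rstrip_bPos_comp_regQB (k : ℕ+) : rstrip (bPos k) ∘ₗ regQB = regQB ∘ₗ rstrip (bPos k) :=
  LinearMap.ext fun x => rstrip_bPos_reg k x

theorem rstrip_b0_comp_regQB : rstrip b0 ∘ₗ regQB + regQB ∘ₗ strip = regQB ∘ₗ rstrip b0 :=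
  LinearMap.ext fun x => by
    simp [regQB, rstrip_b0_reg]

/-- The regularized coproduct with values in `ℚ⟨B⟩ ⊗ ℚ⟨B⟩`. -/
def regDec : QB →ₗ[ℚ] QB ⊗[ℚ] QB := TensorProduct.map regQB regQB ∘ₗ dec

theorem lTensor_rstrip_bPos_regDec (k : ℕ+) (x : QB) :
    (rstrip (bPos k)).lTensor QB (regDec x) = regDec (rstrip (bPos k) x) := by
  rw [regDec, LinearMap.comp_apply, LinearMap.comp_apply, ← lTensor_rstrip_dec,
    LinearMap.lTensor_map, rstrip_bPos_comp_regQB, LinearMap.map_lTensor]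

/-- By `rstrip_b0_reg`, deletion in either factor leaves a correction by `strip`. In the left factor
it is zero because no word of x starts in b_0. In the right factor, `lTensor_strip_dec` identifies
it with the action of deletion on the left, so it cancels in the sum. -/
theorem rstrip_b0_regDec {x : QB} (hx : x ∈ QB0) :
    (rstrip b0).rTensor QB (regDec x) + (rstrip b0).lTensor QB (regDec x) =
      regDec (rstrip b0 x) := by
  have h1 : TensorProduct.map (regQB ∘ₗ strip) regQB (dec x) = 0 := by
    rw [← LinearMap.map_rTensor, rTensor_strip_dec, (mem_QB0_iff _).1 hx, map_zero, map_zero]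
  have h2 : TensorProduct.map regQB (regQB ∘ₗ strip) (dec x) =
      TensorProduct.map (regQB ∘ₗ rstrip b0) regQB (dec x) := by
    rw [← LinearMap.map_lTensor, lTensor_strip_dec, LinearMap.map_rTensor]
  have h3 := congrArg (fun f => TensorProduct.map f regQB (dec x)) rstrip_b0_comp_regQB
  have h4 := congrArg (fun f => TensorProduct.map regQB f (dec x)) rstrip_b0_comp_regQB
  simp only [TensorProduct.map_add_left, TensorProduct.map_add_right, LinearMap.add_apply, h1, h2,
    add_zero] at h3 h4
  rw [regDec, LinearMap.comp_apply, LinearMap.comp_apply, ← lTensor_rstrip_dec,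
    LinearMap.rTensor_map, LinearMap.lTensor_map, LinearMap.map_lTensor, h3, ← h4, add_comm]

/-! ## Linear maps acting on the coefficients of power series -/

section Coeffwise

variable {σ τ R S : Type} [CommRing R] [Algebra ℚ R] [CommRing S] [Algebra ℚ S]

/-- The action of a linear map on the coefficients of a power series. -/
def coeffwise (f : R →ₗ[ℚ] S) (p : MvPowerSeries σ R) : MvPowerSeries σ S := fun e =>
  f (MvPowerSeries.coeff e p)

theorem coeff_coeffwise (f : R →ₗ[ℚ] S) (p : MvPowerSeries σ R) (e : σ →₀ ℕ) :
    MvPowerSeries.coeff e (coeffwise f p) = f (MvPowerSeries.coeff e p) := rfl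

theorem coeffwise_comp {T : Type} [CommRing T] [Algebra ℚ T] (g : S →ₗ[ℚ] T) (f : R →ₗ[ℚ] S)
    (p : MvPowerSeries σ R) : coeffwise (g ∘ₗ f) p = coeffwise g (coeffwise f p) := rfl

theorem coeffwise_sum {ι : Type} (f : R →ₗ[ℚ] S) (s : Finset ι) (p : ι → MvPowerSeries σ R) :
    coeffwise f (∑ i ∈ s, p i) = ∑ i ∈ s, coeffwise f (p i) := by
  ext e
  simp [coeff_coeffwise]

theorem coeffwise_X_mul (f : R →ₗ[ℚ] S) (i : σ) (p : MvPowerSeries σ R) :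
    coeffwise f (MvPowerSeries.X i * p) = MvPowerSeries.X i * coeffwise f p := by
  classical
  ext e
  rw [coeff_coeffwise, MvPowerSeries.X, MvPowerSeries.X, MvPowerSeries.coeff_monomial_mul,
    MvPowerSeries.coeff_monomial_mul]
  split_ifs <;> simp [coeff_coeffwise]

/-- The substituted series have rational coefficients, so each coefficient of the result is a finite
rational combination of coefficients of p. Hence linearity of f suffices, although f need not be
multiplicative. -/
theorem coeffwise_subst (f : R →ₗ[ℚ] S) (a : σ → MvPowerSeries τ ℚ)
    (hR : MvPowerSeries.HasSubst fun i => MvPowerSeries.map (algebraMap ℚ R) (a i))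
    (hS : MvPowerSeries.HasSubst fun i => MvPowerSeries.map (algebraMap ℚ S) (a i))
    (p : MvPowerSeries σ R) :
    coeffwise f (p.subst fun i => MvPowerSeries.map (algebraMap ℚ R) (a i)) =
      (coeffwise f p).subst fun i => MvPowerSeries.map (algebraMap ℚ S) (a i) := by
  ext e
  have key : ∀ (T : Type) [CommRing T] [Algebra ℚ T] (d : σ →₀ ℕ),
      MvPowerSeries.coeff e (d.prod fun s n => MvPowerSeries.map (algebraMap ℚ T) (a s) ^ n) =
        algebraMap ℚ T (MvPowerSeries.coeff e (d.prod fun s n => a s ^ n)) := by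
    intro T _ _ d
    have : (d.prod fun s n => MvPowerSeries.map (algebraMap ℚ T) (a s) ^ n) =
        MvPowerSeries.map (algebraMap ℚ T) (d.prod fun s n => a s ^ n) := by
      rw [Finsupp.prod, Finsupp.prod, map_prod]
      simp only [map_pow]
    rw [this, MvPowerSeries.coeff_map]
  have hfin := MvPowerSeries.coeff_subst_finite hR p e
  rw [coeff_coeffwise, MvPowerSeries.coeff_subst hR, MvPowerSeries.coeff_subst hS]
  refine (f.toAddMonoidHom.map_finsum hfin).trans (finsum_congr fun d => ?_)
  simp only [key, coeff_coeffwise, LinearMap.toAddMonoidHom_coe, smul_eq_mul]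
  rw [mul_comm, ← Algebra.smul_def, map_smul, mul_comm, ← Algebra.smul_def]

end Coeffwise

/-! ## Generating series of words -/

/-- The word `y_{k₁,m₁} … y_{k_d,m_d}` with exponents `k₁ - 1, …, k_d - 1, m₁, …, m_d`. -/
def wordOf {d : ℕ} (e : Fin d ⊕ Fin d →₀ ℕ) : List YLetter :=
  List.ofFn fun i => YLetter.mk (e (Sum.inl i)).succPNat (e (Sum.inr i))

theorem wordOf_expo (w : List YLetter) : wordOf (expo w) = w := by
  refine (congrArg List.ofFn (funext fun i => ?_)).trans (List.ofFn_get w)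
  simp [expo]

section

variable {R S : Type} [CommRing R] [Algebra ℚ R] [CommRing S] [Algebra ℚ S]

theorem coeffMap_wordOf (M : Bimould R) {d : ℕ} (e : Fin d ⊕ Fin d →₀ ℕ) :
    coeffMap M (word (wordOf e)) =
      (∏ i, ((e (Sum.inr i)).factorial : ℚ)) • MvPowerSeries.coeff e (M d) := by
  -- The length is decoupled from d because `(wordOf e).length` equals d only propositionally, while
  -- exponents and bimould components depend on d.
  have key : ∀ (w : List YLetter) (d : ℕ) (h : w.length = d) (e : Fin d ⊕ Fin d →₀ ℕ),
      (∀ i : Fin d, w.get (Fin.cast h.symm i) = ⟨(e (Sum.inl i)).succPNat, e (Sum.inr i)⟩) →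
      coeffMap M (word w) =
        (∏ i, ((e (Sum.inr i)).factorial : ℚ)) • MvPowerSeries.coeff e (M d) := by
    rintro w d rfl e he
    have he' : e = expo w := by
      ext i
      cases i with
      | inl i =>
        have := he i
        simp only [Fin.cast_refl, id_eq, List.get_eq_getElem] at this
        simp [expo, this]
      | inr i =>
        have := he i
        simp only [Fin.cast_refl, id_eq, List.get_eq_getElem] at this
        simp [expo, this]
    subst he'
    rw [coeffMap, lin_word]
    congr 1
    rw [← List.prod_ofFn]
    congr 1
    refine List.ext_getElem (by simp) fun i h1 h2 => ?_
    simp [expo]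
  exact key _ d (by simp [wordOf]) e fun i => by
    simp only [wordOf, List.get_ofFn]
    rfl

theorem coeff_genY {d : ℕ} (e : Fin d ⊕ Fin d →₀ ℕ) : MvPowerSeries.coeff e (genY d) =
    (∏ i, ((e (Sum.inr i)).factorial : ℚ))⁻¹ • word (wordOf e) := rfl

/-- The factorials in `coeffMap` and `genY` cancel. With `lin_ext_genY`, linear maps on ℚ⟨Y^bi⟩
amount to bimoulds, and identities between them can be checked on generating series. -/
theorem coeffwise_coeffMap_genY (M : Bimould R) (d : ℕ) :
    coeffwise (coeffMap M) (genY d) = M d := by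
  ext e
  have : (∏ i, ((e (Sum.inr i)).factorial : ℚ)) ≠ 0 :=
    Finset.prod_ne_zero_iff.2 fun i _ => by positivity
  rw [coeff_coeffwise, coeff_genY, map_smul, coeffMap_wordOf, inv_smul_smul₀ this]

theorem lin_ext_genY {f g : QY →ₗ[ℚ] R}
    (h : ∀ d, coeffwise f (genY d) = coeffwise g (genY d)) : f = g := by
  refine lin_ext fun w => ?_
  have h' := congrArg (MvPowerSeries.coeff (expo w)) (h w.length)
  have : (∏ i, ((expo w (Sum.inr i)).factorial : ℚ))⁻¹ ≠ 0 :=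
    inv_ne_zero <| Finset.prod_ne_zero_iff.2 fun i _ => by positivity
  rw [coeff_coeffwise, coeff_coeffwise, coeff_genY, map_smul, map_smul, wordOf_expo] at h'
  exact smul_right_injective R this h'

theorem map_sharpVar (d : ℕ) (i : Fin d ⊕ Fin d) :
    MvPowerSeries.map (algebraMap ℚ R) (sharpVar ℚ d i) = sharpVar R d i := by
  cases i <;> simp [sharpVar, varX, varY]

theorem map_swapVar (d : ℕ) (i : Fin d ⊕ Fin d) :
    MvPowerSeries.map (algebraMap ℚ R) (swapVar ℚ d i) = swapVar R d i := by
  cases i with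
  | inl i => simp [swapVar, varY]
  | inr i =>
    simp only [swapVar, Sum.elim_inr, varX]
    split_ifs <;> simp

theorem coeffwise_subst_sharpVar (f : R →ₗ[ℚ] S) {d : ℕ} (p : BiSeries R d) :
    coeffwise f (p.subst (sharpVar R d)) = (coeffwise f p).subst (sharpVar S d) := by
  have h := coeffwise_subst f (sharpVar ℚ d)
    (by simpa only [map_sharpVar] using hasSubst_sharpVar R d)
    (by simpa only [map_sharpVar] using hasSubst_sharpVar S d) p
  simpa only [map_sharpVar] using h

theorem coeffwise_subst_swapVar (f : R →ₗ[ℚ] S) {d : ℕ} (p : BiSeries R d) :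
    coeffwise f (p.subst (swapVar R d)) = (coeffwise f p).subst (swapVar S d) := by
  have h := coeffwise_subst f (swapVar ℚ d)
    (by simpa only [map_swapVar] using hasSubst_swapVar R d)
    (by simpa only [map_swapVar] using hasSubst_swapVar S d) p
  simpa only [map_swapVar] using h

end

/-! ## The involutions `swap` and `τ` -/

/-- The exchange of the variables `X_i` and `Y_{d+1-i}`. -/
def flipVar (d : ℕ) : Fin d ⊕ Fin d ≃ Fin d ⊕ Fin d :=
  (Equiv.sumComm _ _).trans (Equiv.sumCongr Fin.revPerm Fin.revPerm)

theorem coeff_rename_equiv {σ R : Type} [Finite σ] [CommRing R] (f : σ ≃ σ) (p : MvPowerSeries σ R)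
    (e : σ →₀ ℕ) : MvPowerSeries.coeff e (MvPowerSeries.rename f p) =
      MvPowerSeries.coeff (e.equivMapDomain f.symm) p := by
  have h := MvPowerSeries.coeff_embDomain_rename f.toEmbedding p (e.equivMapDomain f.symm)
  rw [Finsupp.embDomain_eq_mapDomain] at h
  rw [← h]
  congr 2
  rw [Finsupp.equivMapDomain_eq_mapDomain, ← Finsupp.mapDomain_comp]
  simp

/-- In terms of the exponents k - 1 and m, the rule (k, m) ↦ (m + 1, k - 1) is a plain exchange,
combined with reversal of the blocks. -/
theorem coeffwise_tau_genB0 (d : ℕ) :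
    coeffwise tau (genB0 d) = MvPowerSeries.rename (flipVar d) (genB0 d) := by
  ext1 e
  rw [coeff_rename_equiv, coeff_coeffwise]
  refine (tau_block _).trans ?_
  change _ = block _
  congr 1
  refine List.ext_getElem (by simp [flipBlocks]) fun i h1 h2 => ?_
  simp only [flipBlocks, List.length_reverse, List.length_map, List.length_ofFn] at h1
  simp only [flipBlocks, List.getElem_reverse, List.getElem_map, List.getElem_ofFn,
    List.length_map, List.length_ofFn, Finsupp.equivMapDomain_apply, Equiv.symm_symm]
  have : (⟨d - 1 - i, by omega⟩ : Fin d) = Fin.rev ⟨i, h1⟩ := by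
    ext
    simp only [Fin.val_rev]
    omega
  simp [flipVar, this, Nat.natPred_succPNat]

theorem sum_range_sub_aux {A : Type} [AddCommGroup A] (f : ℕ → A) (n : ℕ) (j : ℕ) :
    ∑ i ∈ Finset.range (j + 1), (f (n + j - i) - f (n + j + 1 - i)) = f n - f (n + j + 1) := by
  induction j with
  | zero => simp
  | succ j ih =>
    rw [Finset.sum_range_succ']
    have : ∀ i, f (n + (j + 1) - (i + 1)) - f (n + (j + 1) + 1 - (i + 1)) =
        f (n + j - i) - f (n + j + 1 - i) := fun i => by
      congr 2 <;> omega
    simp only [this, ih, Nat.sub_zero]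
    rw [show n + (j + 1) = n + j + 1 by omega]
    abel

/-- For X_i both sides are Y_1 + … + Y_{d+1-i}. For Y_i the partial sum X_d + (X_{d-1} - X_d) + …
telescopes to X_{d+1-i}. -/
theorem subst_swapVar_sharpVar {R : Type} [CommRing R] {d : ℕ} (s : Fin d ⊕ Fin d) :
    (sharpVar R d s).subst (swapVar R d) = (MvPowerSeries.X (flipVar d s) : BiSeries R d).subst
      (sharpVar R d) := by
  rw [MvPowerSeries.subst_X (hasSubst_sharpVar R d)]
  have hs := hasSubst_swapVar R d
  cases s with
  | inl i =>
    simp only [sharpVar, Sum.elim_inl, varX, MvPowerSeries.subst_X hs]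
    simp [swapVar, flipVar]
  | inr i =>
    simp only [sharpVar, Sum.elim_inr, varY, ← MvPowerSeries.coe_substAlgHom hs, map_sum]
    simp only [MvPowerSeries.coe_substAlgHom hs, MvPowerSeries.subst_X hs]
    simp only [swapVar, Sum.elim_inr, flipVar, Equiv.trans_apply, Equiv.sumComm_apply,
      Sum.swap_inr, Equiv.sumCongr_apply, Sum.map_inl, Sum.elim_inl, Fin.revPerm_apply]
    -- Extending the variables by X_{d+1} = 0 makes the first term X_d a difference like all the
    -- others.
    let g : ℕ → BiSeries R d := fun n => if h : n < d then varX ⟨n, h⟩ else 0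
    have h1 : ∀ j : Fin d, (varX j.rev - if h : (j.rev : ℕ) + 1 < d then
        varX ⟨j.rev + 1, h⟩ else 0 : BiSeries R d) = g (d - 1 - j) - g (d - 1 + 1 - j) := by
      intro j
      have e1 : (j.rev : ℕ) = d - 1 - j := by
        simp only [Fin.val_rev]
        omega
      have e2 : d - 1 + 1 - (j : ℕ) = j.rev + 1 := by
        rw [e1]
        omega
      rw [← e1, e2]
      simp only [g]
      rw [dif_pos j.rev.2]
    rw [Finset.sum_congr rfl fun j _ => h1 j]
    have h2 : ∑ j ∈ Finset.Iic i, (g (d - 1 - j) - g (d - 1 + 1 - j)) =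
        ∑ j ∈ Finset.range (i + 1), (g (d - 1 - j) - g (d - 1 + 1 - j)) := by
      rw [Nat.range_succ_eq_Iic, ← Fin.map_valEmbedding_Iic, Finset.sum_map]
      rfl
    have hi := i.2
    have h3 := sum_range_sub_aux g (d - 1 - i) i
    rw [show d - 1 - i + i = d - 1 by omega] at h3
    rw [h2, h3]
    have e1 : d - 1 - (i : ℕ) = i.rev := by
      simp only [Fin.val_rev]
      omega
    rw [e1]
    simp only [g]
    rw [dif_pos i.rev.2, dif_neg (by omega), sub_zero]

theorem phiSharp_comp_swapY : phiSharp ∘ₗ swapY = tau ∘ₗ phiSharp := by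
  refine lin_ext_genY fun d => ?_
  rw [coeffwise_comp, coeffwise_comp, swapY, coeffwise_coeffMap_genY, swapBimould,
    coeffwise_subst_swapVar, phiSharp, coeffwise_coeffMap_genY, sharp, coeffwise_subst_sharpVar,
    coeffwise_tau_genB0, MvPowerSeries.rename_eq_subst,
    MvPowerSeries.subst_comp_subst_apply (hasSubst_sharpVar _ d) (hasSubst_swapVar _ d),
    MvPowerSeries.subst_comp_subst_apply (MvPowerSeries.HasSubst.X_comp _) (hasSubst_sharpVar _ d)]
  congr 1
  funext s
  exact subst_swapVar_sharpVar s

/-! ## Deletion of last letters on generating series -/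

theorem coeff_X_pow_mul_of {σ R : Type} [CommRing R] (i : σ) (n : ℕ) (p : MvPowerSeries σ R)
    (e : σ →₀ ℕ) : MvPowerSeries.coeff e (MvPowerSeries.X i ^ n * p) =
      if n ≤ e i then MvPowerSeries.coeff (e - Finsupp.single i n) p else 0 := by
  classical
  rw [MvPowerSeries.X_pow_eq, MvPowerSeries.coeff_monomial_mul]
  simp only [Finsupp.single_le_iff, one_mul]

theorem coeff_X_mul_of {σ R : Type} [CommRing R] (i : σ) (p : MvPowerSeries σ R)
    (e : σ →₀ ℕ) : MvPowerSeries.coeff e (MvPowerSeries.X i * p) =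
      if 1 ≤ e i then MvPowerSeries.coeff (e - Finsupp.single i 1) p else 0 := by
  rw [← coeff_X_pow_mul_of, pow_one]

theorem derivYWord_ofFn {d : ℕ} (f : Fin d → YLetter) : derivYWord (List.ofFn f) =
    ∑ j, ((f j).m : ℚ) • word (List.ofFn (Function.update f j (f j).pred)) := by
  induction d with
  | zero => simp [derivYWord]
  | succ d ih =>
    rw [List.ofFn_succ, derivYWord, ih, Fin.sum_univ_succ, map_sum]
    congr 1
    · rw [List.ofFn_succ]
      simp
    · refine Finset.sum_congr rfl fun j _ => ?_
      rw [map_smul, cons_word, List.ofFn_succ (f := Function.update f j.succ _),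
        Function.update_of_ne (Fin.succ_ne_zero j).symm]
      congr 4
      funext i
      by_cases h : i = j
      · subst h
        simp
      · rw [Function.update_of_ne h, Function.update_of_ne (by simpa using h)]

theorem wordOf_sub_single {d : ℕ} (e : Fin d ⊕ Fin d →₀ ℕ) (j : Fin d) :
    wordOf (e - Finsupp.single (Sum.inr j) 1) =
      List.ofFn (Function.update (fun i => YLetter.mk (e (Sum.inl i)).succPNat (e (Sum.inr i))) j
        (YLetter.pred ⟨(e (Sum.inl j)).succPNat, e (Sum.inr j)⟩)) := by
  rw [wordOf]
  congr 1
  funext i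
  by_cases h : i = j
  · subst h
    simp [YLetter.pred]
  · rw [Function.update_of_ne h]
    simp [Ne.symm h]

theorem prod_factorial_sub_single {d : ℕ} (e : Fin d ⊕ Fin d →₀ ℕ) (j : Fin d)
    (h : e (Sum.inr j) ≠ 0) : (∏ i, ((e (Sum.inr i)).factorial : ℚ)) =
      e (Sum.inr j) * ∏ i, ((((e - Finsupp.single (Sum.inr j) 1 : _ →₀ ℕ)
        (Sum.inr i)).factorial : ℕ) : ℚ) := by
  rw [← Finset.mul_prod_erase _ _ (Finset.mem_univ j),
    ← Finset.mul_prod_erase _ (fun i => ((((e - Finsupp.single (Sum.inr j) 1 : _ →₀ ℕ)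
        (Sum.inr i)).factorial : ℕ) : ℚ)) (Finset.mem_univ j), ← mul_assoc]
  congr 1
  · rw [← Nat.mul_factorial_pred h]
    simp
  · refine Finset.prod_congr rfl fun i hi => ?_
    have : j ≠ i := (Finset.ne_of_mem_erase hi).symm
    simp [this]

/-- With the normalization Y^m/m!, the factor m in `derivY` turns 1/m! into 1/(m-1)!, so lowering
the j-th second index is multiplication by Y_j. -/
theorem coeffwise_derivY_genY (d : ℕ) :
    coeffwise derivY (genY d) = (∑ j : Fin d, varY j) * genY d := by
  classical
  ext1 e
  rw [coeff_coeffwise, coeff_genY, map_smul, derivY, lin_word, wordOf, derivYWord_ofFn,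
    Finset.sum_mul, map_sum, Finset.smul_sum]
  refine Finset.sum_congr rfl fun j _ => ?_
  rw [← wordOf_sub_single, varY, coeff_X_mul_of]
  split_ifs with h
  · have h0 : e (Sum.inr j) ≠ 0 := by omega
    have h1 : ((e (Sum.inr j) : ℕ) : ℚ) ≠ 0 := by exact_mod_cast h0
    rw [coeff_genY, prod_factorial_sub_single e j h0, smul_smul, mul_inv, mul_comm, ← mul_assoc,
      mul_inv_cancel₀ h1, one_mul]
  · have h0 : e (Sum.inr j) = 0 := by omega
    simp [h0]

/-- The inclusion of the variables `X_1, …, X_d, Y_1, …, Y_d`. -/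
def initVar (d : ℕ) : Fin d ⊕ Fin d ↪ Fin (d + 1) ⊕ Fin (d + 1) :=
  Function.Embedding.sumMap Fin.castSuccEmb Fin.castSuccEmb

/-- The exponents of `X_1, …, X_d, Y_1, …, Y_d`. -/
def initExp {d : ℕ} (e : Fin (d + 1) ⊕ Fin (d + 1) →₀ ℕ) : Fin d ⊕ Fin d →₀ ℕ :=
  e.comapDomain (initVar d) (initVar d).injective.injOn

theorem eq_embDomain_initExp {d : ℕ} {e : Fin (d + 1) ⊕ Fin (d + 1) →₀ ℕ}
    (h1 : e (Sum.inl (Fin.last d)) = 0) (h2 : e (Sum.inr (Fin.last d)) = 0) :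
    e = (initExp e).embDomain (initVar d) := by
  have key : ∀ i, e (initVar d i) = (initExp e).embDomain (initVar d) (initVar d i) := fun i => by
    rw [Finsupp.embDomain_apply_self]
    rfl
  have hl : ∀ i, i ∉ Set.range (initVar d) → (initExp e).embDomain (initVar d) i = 0 := fun i hi =>
    Finsupp.embDomain_of_notMem_range _ _ _ hi
  ext i
  cases i with
  | inl i =>
    induction i using Fin.lastCases with
    | last =>
      rw [h1, hl]
      rintro ⟨i | i, hi⟩
      · simp [initVar, Fin.castSucc_ne_last] at hi
      · simp [initVar] at hi
    | cast i => exact key (Sum.inl i)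
  | inr i =>
    induction i using Fin.lastCases with
    | last =>
      rw [h2, hl]
      rintro ⟨i | i, hi⟩
      · simp [initVar] at hi
      · simp [initVar, Fin.castSucc_ne_last] at hi
    | cast i => exact key (Sum.inr i)

theorem coeff_rename_initVar {R : Type} [CommRing R] {d : ℕ} (p : BiSeries R d)
    (e : Fin (d + 1) ⊕ Fin (d + 1) →₀ ℕ) :
    MvPowerSeries.coeff e (MvPowerSeries.rename (initVar d) p) =
      if e (Sum.inl (Fin.last d)) = 0 ∧ e (Sum.inr (Fin.last d)) = 0 then
        MvPowerSeries.coeff (initExp e) p else 0 := by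
  split_ifs with h
  · conv_lhs => rw [eq_embDomain_initExp h.1 h.2]
    exact MvPowerSeries.coeff_embDomain_rename _ _ _
  · refine MvPowerSeries.coeff_rename_eq_zero _ _ ?_
    rintro ⟨x, rfl⟩
    rw [← Finsupp.embDomain_eq_mapDomain] at h
    refine h ⟨Finsupp.embDomain_of_notMem_range _ _ _ ?_, Finsupp.embDomain_of_notMem_range _ _ _ ?_⟩
    · rintro ⟨i | i, hi⟩ <;> simp [initVar, Fin.castSucc_ne_last] at hi
    · rintro ⟨i | i, hi⟩ <;> simp [initVar, Fin.castSucc_ne_last] at hi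

theorem coeff_X_pow_mul_rename_initVar {R : Type} [CommRing R] {d : ℕ} (n : ℕ) (p : BiSeries R d)
    (e : Fin (d + 1) ⊕ Fin (d + 1) →₀ ℕ) :
    MvPowerSeries.coeff e (varX (Fin.last d) ^ n * MvPowerSeries.rename (initVar d) p) =
      if e (Sum.inl (Fin.last d)) = n ∧ e (Sum.inr (Fin.last d)) = 0 then
        MvPowerSeries.coeff (initExp e) p else 0 := by
  classical
  rw [varX, coeff_X_pow_mul_of]
  have h1 : initExp (e - Finsupp.single (Sum.inl (Fin.last d)) n) = initExp e := by
    ext i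
    cases i <;> simp [initExp, initVar]
  rw [coeff_rename_initVar, h1]
  simp only [Finsupp.coe_tsub, Pi.sub_apply, Finsupp.single_eq_same]
  have h2 : (Finsupp.single (Sum.inl (Fin.last d)) n : Fin (d + 1) ⊕ Fin (d + 1) →₀ ℕ)
      (Sum.inr (Fin.last d)) = 0 := by simp
  rw [h2, Nat.sub_zero]
  split_ifs <;> first | rfl | omega

theorem coeffwise_X_pow_mul_rename {R S : Type} [CommRing R] [Algebra ℚ R] [CommRing S]
    [Algebra ℚ S] (f : R →ₗ[ℚ] S) {d : ℕ} (n : ℕ) (p : BiSeries R d) :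
    coeffwise f (varX (Fin.last d) ^ n * MvPowerSeries.rename (initVar d) p) =
      varX (Fin.last d) ^ n * MvPowerSeries.rename (initVar d) (coeffwise f p) := by
  ext1 e
  rw [coeff_coeffwise, coeff_X_pow_mul_rename_initVar, coeff_X_pow_mul_rename_initVar]
  split_ifs
  · rfl
  · exact map_zero f

theorem rename_sharpVar {R : Type} [CommRing R] {d : ℕ} (s : Fin d ⊕ Fin d) :
    MvPowerSeries.rename (initVar d) (sharpVar R d s) = sharpVar R (d + 1) (initVar d s) := by
  cases s with
  | inl i => exact MvPowerSeries.rename_X _ _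
  | inr i =>
    simp only [sharpVar, Sum.elim_inr, map_sum, varY, MvPowerSeries.rename_X, initVar,
      Function.Embedding.coe_sumMap, Sum.map_inr, Fin.coe_castSuccEmb]
    rw [← Fin.map_castSuccEmb_Iic, Finset.sum_map]
    rfl

/-- The substitution is triangular: the images of the first d pairs of variables do not involve the
last pair, and the last X is fixed. -/
theorem subst_sharpVar_rename {R : Type} [CommRing R] {d : ℕ} (n : ℕ) (p : BiSeries R d) :
    (varX (Fin.last d) ^ n * MvPowerSeries.rename (initVar d) p).subst (sharpVar R (d + 1)) =
      varX (Fin.last d) ^ n * MvPowerSeries.rename (initVar d) (p.subst (sharpVar R d)) := by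
  have hs := hasSubst_sharpVar R (d + 1)
  rw [MvPowerSeries.subst_mul hs, MvPowerSeries.subst_pow hs, varX, MvPowerSeries.subst_X hs,
    MvPowerSeries.rename_eq_subst, MvPowerSeries.rename_eq_subst,
    MvPowerSeries.subst_comp_subst_apply (MvPowerSeries.HasSubst.X_comp _) hs,
    MvPowerSeries.subst_comp_subst_apply (hasSubst_sharpVar R d) (MvPowerSeries.HasSubst.X_comp _)]
  congr 2
  funext s
  rw [← MvPowerSeries.rename_eq_subst, rename_sharpVar, Function.comp_apply,
    MvPowerSeries.subst_X hs]

theorem wordOf_succ {d : ℕ} (e : Fin (d + 1) ⊕ Fin (d + 1) →₀ ℕ) : wordOf e =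
    wordOf (initExp e) ++ [⟨(e (Sum.inl (Fin.last d))).succPNat, e (Sum.inr (Fin.last d))⟩] := by
  rw [wordOf, List.ofFn_succ', List.concat_eq_append]
  rfl

/-- Only words ending in y_{k,0} survive, that is, exponent k - 1 in the last X and exponent 0 in
the last Y. -/
theorem coeffwise_rstrip_genY (k : ℕ+) (d : ℕ) :
    coeffwise (rstrip (yZero k)) (genY (d + 1)) =
      varX (Fin.last d) ^ k.natPred * MvPowerSeries.rename (initVar d) (genY d) := by
  ext1 e
  rw [coeff_coeffwise, coeff_genY, coeff_X_pow_mul_rename_initVar, map_smul, wordOf_succ,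
    ← snoc_word]
  split_ifs with h
  · have : (⟨(e (Sum.inl (Fin.last d))).succPNat, e (Sum.inr (Fin.last d))⟩ : YLetter) =
        yZero k := by
      rw [h.1, h.2, PNat.succPNat_natPred, yZero]
    rw [this, rstrip_snoc_self, coeff_genY, Fin.prod_univ_castSucc, h.2]
    simp [initExp, initVar]
  · rw [rstrip_snoc_of_ne, smul_zero]
    intro h'
    simp only [yZero, YLetter.mk.injEq] at h'
    refine h ⟨?_, h'.2⟩
    rw [← h'.1, Nat.natPred_succPNat]

/-! ## The map `φ_#` with values in `ℚ⟨B⟩` -/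

/-- The map `φ_#` with values in `ℚ⟨B⟩`. -/
def phiQB : QY →ₗ[ℚ] QB := QB0.val.toLinearMap ∘ₗ phiSharp

/-- The generating series `genB0` with coefficients in `ℚ⟨B⟩`. -/
def genB : Bimould QB := fun d => coeffwise QB0.val.toLinearMap (genB0 d)

/-- The list `(k₁, m₁), …, (k_d, m_d)` with exponents `k₁ - 1, …, k_d - 1, m₁, …, m_d`. -/
def blocksOf {d : ℕ} (e : Fin d ⊕ Fin d →₀ ℕ) : List (ℕ+ × ℕ) :=
  List.ofFn fun i => ((e (Sum.inl i)).succPNat, e (Sum.inr i))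

theorem coeff_genB {d : ℕ} (e : Fin d ⊕ Fin d →₀ ℕ) :
    MvPowerSeries.coeff e (genB d) = word (blockWord (blocksOf e)) := rfl

theorem coeffwise_phiQB_genY (d : ℕ) :
    coeffwise phiQB (genY d) = (genB d).subst (sharpVar QB d) := by
  rw [phiQB, coeffwise_comp, phiSharp, coeffwise_coeffMap_genY, sharp, coeffwise_subst_sharpVar,
    genB]

theorem blockWord_blocksOf_succ {d : ℕ} (e : Fin (d + 1) ⊕ Fin (d + 1) →₀ ℕ) :
    blockWord (blocksOf e) = blockWord (blocksOf (initExp e)) ++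
      bPos (e (Sum.inl (Fin.last d))).succPNat ::
        List.replicate (e (Sum.inr (Fin.last d))) b0 := by
  rw [blocksOf, List.ofFn_succ', List.concat_eq_append, blockWord, List.flatMap_append]
  simp only [List.flatMap_cons, List.flatMap_nil, List.append_nil]
  rfl

theorem coeffwise_rstrip_bPos_genB (k : ℕ+) (d : ℕ) :
    coeffwise (rstrip (bPos k)) (genB (d + 1)) =
      varX (Fin.last d) ^ k.natPred * MvPowerSeries.rename (initVar d) (genB d) := by
  ext1 e
  rw [coeff_coeffwise, coeff_genB, coeff_X_pow_mul_rename_initVar, blockWord_blocksOf_succ]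
  rcases h2 : e (Sum.inr (Fin.last d)) with _ | n
  · rw [List.replicate_zero, ← snoc_word]
    simp only [and_true]
    split_ifs with h
    · rw [h, PNat.succPNat_natPred, rstrip_snoc_self, coeff_genB]
    · rw [rstrip_snoc_of_ne]
      intro h'
      apply h
      rw [← bPos_injective h', Nat.natPred_succPNat]
  · rw [if_neg (by simp), List.replicate_succ', ← List.cons_append, ← List.append_assoc,
      ← snoc_word, rstrip_snoc_of_ne (bPos_ne_b0 k).symm]

/-- The exponent of the last Y counts the b_0 at the end, so deletion shifts it by one. Words ending
in some b_k are killed, which matches the vanishing of the Y-free part on the right. -/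
theorem coeffwise_rstrip_b0_genB (d : ℕ) :
    coeffwise (rstrip b0) (genB (d + 1)) = varY (Fin.last d) * genB (d + 1) := by
  classical
  ext1 e
  rw [coeff_coeffwise, coeff_genB, varY, coeff_X_mul_of, coeff_genB, blockWord_blocksOf_succ, blockWord_blocksOf_succ]
  have h1 : initExp (e - Finsupp.single (Sum.inr (Fin.last d)) 1) = initExp e := by
    ext i
    cases i <;> simp [initExp, initVar]
  rw [h1]
  rcases h2 : e (Sum.inr (Fin.last d)) with _ | n
  · rw [List.replicate_zero, ← snoc_word, rstrip_snoc_of_ne (bPos_ne_b0 _), if_neg (by omega)]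
  · rw [if_pos (by omega), List.replicate_succ', ← List.cons_append, ← List.append_assoc,
      ← snoc_word, rstrip_snoc_self]
    simp [h2]

theorem coeffwise_zero_depth {R S : Type} [CommRing R] [Algebra ℚ R] [CommRing S] [Algebra ℚ S]
    {f g : R →ₗ[ℚ] S} {p q : BiSeries R 0}
    (h : f (MvPowerSeries.coeff 0 p) = g (MvPowerSeries.coeff 0 q)) :
    coeffwise f p = coeffwise g q := by
  ext1 e
  rw [Subsingleton.elim e 0]
  exact h

theorem phiQB_nil : phiQB (word []) = word [] := by
  have h := congrArg (MvPowerSeries.coeff 0) (coeffwise_phiQB_genY 0)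
  have h1 : sharpVar QB 0 = MvPowerSeries.X := funext fun i => by
    rcases i with i | i <;> exact i.elim0
  rw [h1, MvPowerSeries.subst_self] at h
  simpa [coeff_coeffwise, coeff_genY, coeff_genB, wordOf, blocksOf, blockWord] using h

theorem phiQB_one : phiQB 1 = 1 := phiQB_nil

/-- The left side multiplies the series by the last Y before the substitution, hence by the sum of
all Y_j after it; this is the factor produced by `derivY`. -/
theorem rstrip_b0_comp_phiQB : rstrip b0 ∘ₗ phiQB = phiQB ∘ₗ derivY := by
  refine lin_ext_genY fun d => ?_
  rcases d with _ | d
  · refine coeffwise_zero_depth ?_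
    rw [coeff_genY]
    simp [wordOf, phiQB_nil, rstrip_nil, derivY_nil]
  · have hs := hasSubst_sharpVar QB (d + 1)
    have h1 : sharpVar QB (d + 1) (Sum.inr (Fin.last d)) = ∑ j, varY j := by
      simp only [sharpVar, Sum.elim_inr]
      congr 1
      ext j
      simp [Fin.le_last]
    rw [coeffwise_comp, coeffwise_comp, coeffwise_phiQB_genY, coeffwise_subst_sharpVar,
      coeffwise_rstrip_b0_genB, MvPowerSeries.subst_mul hs, varY, MvPowerSeries.subst_X hs, h1,
      coeffwise_derivY_genY, Finset.sum_mul, Finset.sum_mul, coeffwise_sum]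
    refine Finset.sum_congr rfl fun j _ => ?_
    rw [varY, varY, coeffwise_X_mul, coeffwise_phiQB_genY]

theorem rstrip_bPos_comp_phiQB (k : ℕ+) :
    rstrip (bPos k) ∘ₗ phiQB = phiQB ∘ₗ rstrip (yZero k) := by
  refine lin_ext_genY fun d => ?_
  rcases d with _ | d
  · refine coeffwise_zero_depth ?_
    rw [coeff_genY]
    simp [wordOf, phiQB_nil, rstrip_nil]
  · rw [coeffwise_comp, coeffwise_comp, coeffwise_phiQB_genY, coeffwise_subst_sharpVar,
      coeffwise_rstrip_bPos_genB, subst_sharpVar_rename, coeffwise_rstrip_genY,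
      coeffwise_X_pow_mul_rename, coeffwise_phiQB_genY]

theorem rstrip_b0_phiQB (x : QY) : rstrip b0 (phiQB x) = phiQB (derivY x) :=
  congrArg (fun f => f x) rstrip_b0_comp_phiQB

theorem rstrip_bPos_phiQB (k : ℕ+) (x : QY) :
    rstrip (bPos k) (phiQB x) = phiQB (rstrip (yZero k) x) :=
  congrArg (fun f => f x) (rstrip_bPos_comp_phiQB k)

/-! ## `φ_#` is compatible with products, gradings and coproducts -/

theorem counit_phiQB (x : QY) : counit (phiQB x) = counit x := by
  have : counit ∘ₗ phiQB = counit := by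
    refine lin_ext_genY fun d => ?_
    rcases d with _ | d
    · refine coeffwise_zero_depth ?_
      rw [coeff_genY]
      simp [wordOf, phiQB_nil, counit_nil]
    · have h1 : coeffwise counit (genB (d + 1)) = 0 := by
        ext1 e
        rw [coeff_coeffwise, coeff_genB, blocksOf, List.ofFn_succ]
        exact counit_word_cons _ _
      have h2 : coeffwise counit (genY (d + 1)) = 0 := by
        ext1 e
        rw [coeff_coeffwise, coeff_genY, map_smul, wordOf, List.ofFn_succ, counit_word_cons,
          smul_zero, map_zero]
      rw [coeffwise_comp, coeffwise_phiQB_genY, coeffwise_subst_sharpVar, h1, h2,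
        ← MvPowerSeries.coe_substAlgHom (hasSubst_sharpVar ℚ (d + 1)), map_zero]
  exact congrArg (fun f => f x) this

/-- The defect of multiplicativity is shown to have no coefficients, by induction on the word from
the right. Deleting a letter turns the defect at (x, y) into a sum of defects at other pairs,
because the operators on both sides obey the same product rules. -/
theorem phiQB_mul (x y : QY) : phiQB (x * y) = phiQB x * phiQB y := by
  rw [← sub_eq_zero]
  refine ext_coeff fun w => ?_
  induction w using bWord_induction generalizing x y with
  | nil =>
    rw [← counit_eq_coeff, map_sub, counit_mul, counit_phiQB, counit_phiQB, counit_phiQB,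
      counit_mul, sub_self]
  | b0 w ih =>
    rw [coeff_append_singleton, map_sub, rstrip_b0_mul, rstrip_b0_phiQB, rstrip_b0_phiQB,
      rstrip_b0_phiQB, derivY_mul, map_add, add_sub_add_comm, map_add, ih, ih, add_zero]
  | bPos w k ih =>
    have h : rstrip (bPos k) (phiQB (x * y) - phiQB x * phiQB y) =
        (phiQB (rstrip (yZero k) x * y) - phiQB (rstrip (yZero k) x) * phiQB y) +
        (phiQB (x * rstrip (yZero k) y) - phiQB x * phiQB (rstrip (yZero k) y)) +
        ∑ p ∈ pnatPairs k, (phiQB (rstrip (yZero p.1) x * rstrip (yZero p.2) y) -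
          phiQB (rstrip (yZero p.1) x) * phiQB (rstrip (yZero p.2) y)) := by
      rw [map_sub, rstrip_bPos_mul, rstrip_bPos_phiQB, rstrip_yZero_mul]
      simp only [map_add, map_sum, rstrip_bPos_phiQB, Finset.sum_sub_distrib]
      abel
    rw [coeff_append_singleton, h]
    simp only [map_add, map_sum, ih, add_zero, Finset.sum_const_zero]

theorem bPos_wt (k : ℕ+) : (bPos k).wt = k := by
  simp [BLetter.wt, bPos]

theorem yZero_wt (k : ℕ+) : (yZero k).wt = k := rfl

theorem b0_wt : b0.wt = 1 := rfl

/-- Matching operators lower the weight equally: by 1 for b_0 and `derivY`, by k for b_k and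
y_{k,0}. -/
theorem phiQB_gradeProj (n : ℕ) (x : QY) :
    gradeProj BLetter.wt n (phiQB x) = phiQB (gradeProj YLetter.wt n x) := by
  rw [← sub_eq_zero]
  refine ext_coeff fun w => ?_
  induction w using bWord_induction generalizing n x with
  | nil =>
    rw [← counit_eq_coeff, map_sub, counit_phiQB, counit_gradeProj, counit_gradeProj,
      counit_phiQB, sub_self]
  | b0 w ih =>
    rw [coeff_append_singleton, map_sub, rstrip_b0_phiQB]
    rcases n with _ | n
    · rw [rstrip_gradeProj_of_lt (by rw [b0_wt]; exact one_pos), derivY_gradeProj_zero]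
      simp
    · have h := rstrip_gradeProj_add BLetter.wt b0 n (phiQB x)
      rw [b0_wt] at h
      rw [h, rstrip_b0_phiQB, derivY_gradeProj_succ, ih]
  | bPos w k ih =>
    rw [coeff_append_singleton, map_sub, rstrip_bPos_phiQB]
    rcases lt_or_ge n k with h | h
    · rw [rstrip_gradeProj_of_lt (by rwa [bPos_wt]), rstrip_gradeProj_of_lt (by rwa [yZero_wt])]
      simp
    · obtain ⟨m, rfl⟩ := Nat.exists_eq_add_of_le' h
      have h1 := rstrip_gradeProj_add BLetter.wt (bPos k) m (phiQB x)
      have h2 := rstrip_gradeProj_add YLetter.wt (yZero k) m x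
      rw [bPos_wt] at h1
      rw [yZero_wt] at h2
      rw [h1, h2, rstrip_bPos_phiQB, ih]

/-! ### Bijectivity of φ_#. -/

theorem eq_zero_of_mem_of_rstrip_stable {α : Type} [QuasiShuffleAlphabet α]
    (K : Submodule ℚ (QSh α)) (hK : ∀ x ∈ K, counit x = 0) (h : ∀ a, ∀ x ∈ K, rstrip a x ∈ K)
    {x : QSh α} (hx : x ∈ K) : x = 0 := by
  refine ext_coeff fun w => ?_
  induction w using List.reverseRecOn generalizing x with
  | nil => exact hK x hx
  | append_singleton w a ih =>
    rw [coeff_append_singleton]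
    exact ih (h a x hx)

theorem phiQB_injective : Function.Injective phiQB := by
  rw [← LinearMap.ker_eq_bot, Submodule.eq_bot_iff]
  intro x hx
  refine eq_zero_of_mem_of_rstrip_stable (LinearMap.ker phiQB) (fun x hx => ?_) ?_ hx
  · rw [← counit_phiQB, LinearMap.mem_ker.1 hx, map_zero]
  · have hd : ∀ x ∈ LinearMap.ker phiQB, derivY x ∈ LinearMap.ker phiQB := fun x hx => by
      rw [LinearMap.mem_ker] at *
      rw [← rstrip_b0_phiQB, hx, map_zero]
    rintro ⟨k, m⟩
    induction m with
    | zero =>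
      intro x hx
      rw [LinearMap.mem_ker] at *
      exact (rstrip_bPos_phiQB k x).symm.trans (by rw [hx, map_zero])
    | succ m ih =>
      intro x hx
      have h1 := rstrip_derivY k m x
      -- By the commutator formula this is a combination of operators already known to preserve the
      -- kernel.
      have h2 : (m + 1 : ℚ) • rstrip (⟨k, m + 1⟩ : YLetter) x ∈ LinearMap.ker phiQB := by
        rw [← sub_eq_of_eq_add' h1]
        exact sub_mem (ih _ (hd x hx)) (hd _ (ih x hx))
      have h3 : (m + 1 : ℚ) ≠ 0 := by positivity
      exact (Submodule.smul_mem_iff _ h3).1 h2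

theorem rstrip_yZero_snoc_succ (j k : ℕ+) (m : ℕ) (x : QY) :
    rstrip (yZero j) (snoc ⟨k, m + 1⟩ x) = 0 :=
  rstrip_snoc_of_ne (by simp [yZero]) x

/-- Words ending in `y_{k,m}` have an antiderivative in the span of words ending in some `y_{k,m}`
with `m ≥ 1`. -/
theorem exists_derivY_eq_snoc (w : List YLetter) (k : ℕ+) (m : ℕ) :
    ∃ p : QY, derivY p = snoc ⟨k, m⟩ (word w) ∧ ∀ j, rstrip (yZero j) p = 0 := by
  let P : QY → Prop := fun x => ∀ m : ℕ, ∃ p : QY, derivY p = snoc ⟨k, m⟩ x ∧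
    ∀ j, rstrip (yZero j) p = 0
  have zero : P 0 := fun m => ⟨0, by simp, by simp⟩
  have add : ∀ x y, P x → P y → P (x + y) := fun x y hx hy m => by
    obtain ⟨p, hp, hp'⟩ := hx m
    obtain ⟨q, hq, hq'⟩ := hy m
    exact ⟨p + q, by simp [hp, hq], fun j => by simp [hp', hq']⟩
  have smul : ∀ (r : ℚ) x, P x → P (r • x) := fun r x hx m => by
    obtain ⟨p, hp, hp'⟩ := hx m
    exact ⟨r • p, by simp [hp], fun j => by simp [hp']⟩
  -- Integration by parts: `derivY` of x y_{k,m+1} is (m+1) x y_{k,m} plus `derivY x` followed by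
  -- y_{k,m+1}, and the latter has an antiderivative by hypothesis. The recursion stops because
  -- `derivY` lowers the weight of x.
  have step : ∀ x, P (derivY x) → P x := fun x hx m => by
    obtain ⟨q, hq, hq'⟩ := hx (m + 1)
    have h0 : ((m + 1 : ℕ) : ℚ) ≠ 0 := by positivity
    refine ⟨((m + 1 : ℕ) : ℚ)⁻¹ • (snoc ⟨k, m + 1⟩ x - q), ?_, fun j => ?_⟩
    · rw [map_smul, map_sub, hq, derivY_snoc, add_sub_cancel_left, inv_smul_smul₀ h0]
      rfl
    · rw [map_smul, map_sub, hq', rstrip_yZero_snoc_succ, sub_zero, smul_zero]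
  have key : ∀ (n : ℕ) (x : QY), x ∈ QSh.grade YLetter.wt n → P x := by
    intro n
    induction n with
    | zero =>
      intro x hx
      refine step x ?_
      rw [← (mem_grade_iff _).1 hx, derivY_gradeProj_zero]
      exact zero
    | succ n ih =>
      intro x hx
      refine step x (ih _ ?_)
      rw [mem_grade_iff, ← derivY_gradeProj_succ, (mem_grade_iff _).1 hx]
  exact key _ _ (word_mem_grade _ w) m

theorem exists_derivY_eq (x : QY) (hx : counit x = 0) :
    ∃ p : QY, derivY p = x ∧ ∀ j, rstrip (yZero j) p = 0 := by
  let P : QY → Prop := fun x => ∃ p : QY, derivY p = x - counit x • word [] ∧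
    ∀ j, rstrip (yZero j) p = 0
  have key : ∀ x, P x := by
    refine fun x => word_induction (p := P) ⟨0, by simp, by simp⟩ ?_ ?_ (fun w => ?_) x
    · rintro x y ⟨p, hp, hp'⟩ ⟨q, hq, hq'⟩
      refine ⟨p + q, ?_, fun j => by simp [hp', hq']⟩
      rw [map_add, map_add, hp, hq, add_smul]
      abel
    · rintro r x ⟨p, hp, hp'⟩
      refine ⟨r • p, ?_, fun j => by simp [hp']⟩
      rw [map_smul, map_smul, hp, smul_sub, smul_eq_mul, mul_smul]
    · rcases List.eq_nil_or_concat w with rfl | ⟨u, ⟨k, m⟩, rfl⟩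
      · exact ⟨0, by simp [counit_nil], by simp⟩
      · obtain ⟨p, hp, hp'⟩ := exists_derivY_eq_snoc u k m
        refine ⟨p, ?_, hp'⟩
        rw [hp, List.concat_eq_append, ← snoc_word, counit_snoc, zero_smul, sub_zero]
  obtain ⟨p, hp, hp'⟩ := key x
  exact ⟨p, by rw [hp, hx, zero_smul, sub_zero], hp'⟩

/-- If x = φ_#(q), a preimage p must satisfy `derivY p = q`, to match deletion of b_0, and must have
no words ending in y_{j,0}, since deletion of b_j gives 0. The counit condition excludes the word
b_0, which is not in ℚ⟨B⟩⁰. -/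
theorem snoc_b0_mem_range {x : QB} (hx : x ∈ LinearMap.range phiQB) (h : counit x = 0) :
    snoc b0 x ∈ LinearMap.range phiQB := by
  obtain ⟨q, rfl⟩ := hx
  rw [counit_phiQB] at h
  obtain ⟨p, hp, hp'⟩ := exists_derivY_eq q h
  -- Removing the constant term matches the counit and affects neither `derivY` nor deletion.
  refine ⟨p - counit p • word [], ?_⟩
  rw [← sub_eq_zero]
  refine ext_rstrip_b ?_ ?_ fun k => ?_
  · rw [map_sub, counit_phiQB, counit_snoc, map_sub, map_smul, counit_nil]
    simp
  · rw [map_sub, rstrip_b0_phiQB, rstrip_snoc_self, map_sub, map_smul, derivY_nil, hp]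
    simp
  · rw [map_sub, rstrip_bPos_phiQB, rstrip_snoc_of_ne (bPos_ne_b0 k).symm, map_sub, map_smul,
      rstrip_nil, hp']
    simp

/-- The image of q y_{k,0} has the right deletions of all b_j with j ≥ 1, but deletion of b_0 gives
the image of `derivY q` followed by y_{k,0}. Appending b_0 to that element stays in the range and
corrects the error. -/
theorem snoc_bPos_mem_range {x : QB} (hx : x ∈ LinearMap.range phiQB) (k : ℕ+) :
    snoc (bPos k) x ∈ LinearMap.range phiQB := by
  obtain ⟨q, rfl⟩ := hx
  have h1 : snoc b0 (phiQB (snoc (yZero k) (derivY q))) ∈ LinearMap.range phiQB :=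
    snoc_b0_mem_range ⟨_, rfl⟩ (by rw [counit_phiQB, counit_snoc])
  have h2 : snoc (bPos k) (phiQB q) = phiQB (snoc (yZero k) q) -
      snoc b0 (phiQB (snoc (yZero k) (derivY q))) := by
    rw [← sub_eq_zero]
    refine ext_rstrip_b ?_ ?_ fun j => ?_
    · simp only [map_sub, counit_phiQB, counit_snoc, sub_zero]
    · rw [map_sub, map_sub, rstrip_snoc_of_ne (bPos_ne_b0 k), rstrip_snoc_self, rstrip_b0_phiQB,
        derivY_snoc, show (yZero k).m = 0 from rfl]
      simp
    · rw [map_sub, map_sub, rstrip_snoc_of_ne (bPos_ne_b0 j).symm, rstrip_bPos_phiQB]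
      by_cases h : k = j
      · subst h
        simp only [rstrip_snoc_self, sub_zero, sub_self]
      · rw [rstrip_snoc_of_ne (fun h' => h (bPos_injective h')),
          rstrip_snoc_of_ne (fun h' => h (yZero_injective h'))]
        simp
  rw [h2]
  exact sub_mem ⟨_, rfl⟩ h1

theorem word_mem_range_phiQB (w : List BLetter) (h : w.head? ≠ some b0) :
    word w ∈ LinearMap.range phiQB := by
  induction w using bWord_induction with
  | nil => exact ⟨_, phiQB_nil⟩
  | b0 w ih =>
    cases w with
    | nil => simp at h
    | cons a w =>
      rw [← snoc_word]
      exact snoc_b0_mem_range (ih (by simpa using h)) (counit_word_cons a w)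
  | bPos w k ih =>
    rw [← snoc_word]
    refine snoc_bPos_mem_range (ih ?_) k
    cases w with
    | nil => simp
    | cons a w => simpa using h

theorem range_phiQB : LinearMap.range phiQB = Subalgebra.toSubmodule QB0 := by
  refine le_antisymm ?_ ?_
  · rintro _ ⟨x, rfl⟩
    exact (phiSharp x).2
  · refine Submodule.span_le.2 ?_
    rintro _ ⟨w, hw, rfl⟩
    exact word_mem_range_phiQB w hw

theorem phiSharp_bijective : Function.Bijective phiSharp := by
  constructor
  · intro x y h
    exact phiQB_injective (congrArg Subtype.val h)
  · intro y
    have : (y : QB) ∈ LinearMap.range phiQB := by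
      rw [range_phiQB]
      exact y.2
    obtain ⟨x, hx⟩ := this
    exact ⟨x, Subtype.ext hx⟩

/-! ### Compatibility of φ_# with the coproducts. -/

theorem phiQB_mem (x : QY) : phiQB x ∈ QB0 := (phiSharp x).2

theorem regQB_of_mem {x : QB} (hx : x ∈ QB0) : regQB x = x := reg_of_mem hx

theorem counit_regQB (x : QB) : counit (regQB x) = counit x := by
  induction x using QB_induction with
  | coe x => rw [regQB_of_mem x.2]
  | b0 =>
    rw [counit_word_cons, regQB, LinearMap.comp_apply]
    simp [reg_b0]
  | add x y hx hy => rw [map_add, map_add, hx, hy, map_add]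
  | mul x y hx hy =>
    have : regQB (x * y) = regQB x * regQB y := congrArg Subtype.val (map_mul reg x y)
    rw [this, counit_mul, hx, hy, counit_mul]

theorem slice_map {α β M N : Type} [AddCommGroup M] [Module ℚ M] [AddCommGroup N] [Module ℚ N]
    (f : QSh α →ₗ[ℚ] ℚ) (g : M →ₗ[ℚ] N) (h : QSh β →ₗ[ℚ] QSh α) (t : M ⊗[ℚ] QSh β) :
    slice f (TensorProduct.map g h t) = g (slice (f ∘ₗ h) t) := by
  induction t with
  | zero => simp
  | add x y hx hy => simp only [map_add, hx, hy]
  | tmul x y => simp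

/-- The difference is sliced along words in the right factor, by induction from the right. Deletion
of b_k in that factor passes through both coproducts, while deletion of b_0 is handled by the
coderivation property on both sides. -/
theorem regDec_phiQB (x : QY) : regDec (phiQB x) = TensorProduct.map phiQB phiQB (dec x) := by
  rw [← sub_eq_zero]
  refine slice_ext fun w => ?_
  induction w using bWord_induction generalizing x with
  | nil =>
    have h1 : counit ∘ₗ regQB = counit := LinearMap.ext counit_regQB
    have h2 : counit ∘ₗ phiQB = counit := LinearMap.ext counit_phiQB
    rw [← counit_eq_coeff, map_sub, regDec, LinearMap.comp_apply, slice_map, slice_map, h1, h2,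
      slice_counit_dec, slice_counit_dec, regQB_of_mem (phiQB_mem x), sub_self]
  | b0 w ih =>
    have h1 := rstrip_b0_regDec (phiQB_mem x)
    rw [rstrip_b0_phiQB] at h1
    have h2 : (rstrip b0).rTensor QB (TensorProduct.map phiQB phiQB (dec x)) +
        (rstrip b0).lTensor QB (TensorProduct.map phiQB phiQB (dec x)) =
        TensorProduct.map phiQB phiQB (dec (derivY x)) := by
      rw [LinearMap.rTensor_map, LinearMap.lTensor_map, rstrip_b0_comp_phiQB, dec_derivY, map_add,
        LinearMap.map_rTensor, LinearMap.map_lTensor]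
    -- Deletion on the right is the total action minus deletion on the left. The total action gives
    -- the defect at `derivY x`, and the left action commutes with slicing, so the induction
    -- hypothesis for the shorter word kills both terms.
    have h3 : (rstrip b0).lTensor QB
        (regDec (phiQB x) - TensorProduct.map phiQB phiQB (dec x)) =
        (regDec (phiQB (derivY x)) - TensorProduct.map phiQB phiQB (dec (derivY x))) -
        (rstrip b0).rTensor QB (regDec (phiQB x) - TensorProduct.map phiQB phiQB (dec x)) := by
      rw [← h1, ← h2, map_sub, map_sub]
      abel
    have h4 : coeff (w ++ [b0]) = coeff w ∘ₗ rstrip b0 :=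
      LinearMap.ext fun y => coeff_append_singleton w b0 y
    rw [h4, ← slice_lTensor, h3, map_sub, slice_rTensor, ih, ih, map_zero, sub_zero]
  | bPos w k ih =>
    have h4 : coeff (w ++ [bPos k]) = coeff w ∘ₗ rstrip (bPos k) :=
      LinearMap.ext fun y => coeff_append_singleton w (bPos k) y
    rw [h4, ← slice_lTensor, map_sub, lTensor_rstrip_bPos_regDec, rstrip_bPos_phiQB,
      LinearMap.lTensor_map, rstrip_bPos_comp_phiQB, ← LinearMap.map_lTensor, lTensor_rstrip_dec,
      ih]

end

/-- The axioms of a graded Hopf algebra can be transported along isomorphisms. -/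
theorem IsGradedHopfAlgebra.of_algEquiv {R A B : Type} [Field R] [CommRing A] [Algebra R A]
    [CoalgebraStruct R A] [CommRing B] [Algebra R B] [CoalgebraStruct R B] {S : A →ₗ[R] A}
    {𝒜 : ℕ → Submodule R A} (h : IsGradedHopfAlgebra R S 𝒜) (e : A ≃ₐ[R] B)
    (hcounit : ∀ x, CoalgebraStruct.counit (R := R) (e x) = CoalgebraStruct.counit (R := R) x)
    (hcomul : ∀ x, CoalgebraStruct.comul (R := R) (e x) =
      TensorProduct.map e.toLinearMap e.toLinearMap (CoalgebraStruct.comul (R := R) x)) :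
    IsGradedHopfAlgebra R (e.toLinearMap ∘ₗ S ∘ₗ e.symm.toLinearMap)
      (fun n => (𝒜 n).map e.toLinearMap) := by
  have hcounit' : CoalgebraStruct.counit ∘ₗ e.toLinearMap = CoalgebraStruct.counit (R := R) :=
    LinearMap.ext hcounit
  have hcomul' : CoalgebraStruct.comul ∘ₗ e.toLinearMap =
      TensorProduct.map e.toLinearMap e.toLinearMap ∘ₗ CoalgebraStruct.comul (R := R) :=
    LinearMap.ext hcomul
  have hsymm : e.symm.toLinearMap ∘ₗ e.toLinearMap = LinearMap.id :=
    LinearMap.ext fun x => e.symm_apply_apply x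
  have hmul : LinearMap.mul' R B ∘ₗ TensorProduct.map e.toLinearMap e.toLinearMap =
      e.toLinearMap ∘ₗ LinearMap.mul' R A := by
    ext x y
    simp
  constructor
  · refine LinearMap.ext fun y => ?_
    obtain ⟨x, rfl⟩ := e.surjective y
    have h1 := congrArg (fun f => TensorProduct.map e.toLinearMap
      (TensorProduct.map e.toLinearMap e.toLinearMap) (f x)) h.coassoc
    simp only [LinearMap.comp_apply, LinearEquiv.coe_coe] at h1 ⊢
    rw [hcomul, LinearMap.rTensor_map, LinearMap.lTensor_map, hcomul', ← LinearMap.map_rTensor,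
      ← LinearMap.map_lTensor, ← h1]
    exact (LinearMap.congr_fun (TensorProduct.map_map_comp_assoc_eq e.toLinearMap
      e.toLinearMap e.toLinearMap) _).symm
  · refine LinearMap.ext fun y => ?_
    obtain ⟨x, rfl⟩ := e.surjective y
    have h1 := congrArg (fun f => TensorProduct.map LinearMap.id e.toLinearMap (f x))
      h.rTensor_counit_comp_comul
    simp only [LinearMap.comp_apply] at h1 ⊢
    rw [hcomul, LinearMap.rTensor_map, hcounit']
    rw [LinearMap.map_rTensor, LinearMap.id_comp] at h1
    exact h1
  · refine LinearMap.ext fun y => ?_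
    obtain ⟨x, rfl⟩ := e.surjective y
    have h1 := congrArg (fun f => TensorProduct.map e.toLinearMap LinearMap.id (f x))
      h.lTensor_counit_comp_comul
    simp only [LinearMap.comp_apply] at h1 ⊢
    rw [hcomul, LinearMap.lTensor_map, hcounit']
    rw [LinearMap.map_lTensor, LinearMap.id_comp] at h1
    exact h1
  · rw [← map_one e, hcounit, h.counit_one]
  · intro y y'
    obtain ⟨x, rfl⟩ := e.surjective y
    obtain ⟨x', rfl⟩ := e.surjective y'
    rw [← map_mul, hcounit, hcounit, hcounit, h.counit_mul]
  · rw [← map_one e, hcomul, h.comul_one]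
    exact map_one (Algebra.TensorProduct.map e.toAlgHom e.toAlgHom)
  · intro y y'
    obtain ⟨x, rfl⟩ := e.surjective y
    obtain ⟨x', rfl⟩ := e.surjective y'
    rw [← map_mul, hcomul, hcomul, hcomul, h.comul_mul]
    exact map_mul (Algebra.TensorProduct.map e.toAlgHom e.toAlgHom) _ _
  · refine LinearMap.ext fun y => ?_
    obtain ⟨x, rfl⟩ := e.surjective y
    have h1 := congrArg (fun f => e (f x)) h.mul_antipode_rTensor_comul
    simp only [LinearMap.comp_apply] at h1 ⊢
    rw [hcomul, LinearMap.rTensor_map, LinearMap.comp_assoc, LinearMap.comp_assoc, hsymm,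
      LinearMap.comp_id, ← LinearMap.map_rTensor, hcounit]
    refine ((LinearMap.congr_fun hmul _).trans h1).trans ?_
    simp
  · refine LinearMap.ext fun y => ?_
    obtain ⟨x, rfl⟩ := e.surjective y
    have h1 := congrArg (fun f => e (f x)) h.mul_antipode_lTensor_comul
    simp only [LinearMap.comp_apply] at h1 ⊢
    rw [hcomul, LinearMap.lTensor_map, LinearMap.comp_assoc, LinearMap.comp_assoc, hsymm,
      LinearMap.comp_id, ← LinearMap.map_lTensor, hcounit]
    refine ((LinearMap.congr_fun hmul _).trans h1).trans ?_
    simp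
  · have h1 := h.isInternal
    rw [DirectSum.isInternal_submodule_iff_iSupIndep_and_iSup_eq_top] at h1 ⊢
    -- Independence is a property of the lattice of subspaces, so it passes through the order
    -- isomorphism induced by e.
    refine ⟨h1.1.map_orderIso (Submodule.orderIsoMapComap e.toLinearEquiv), ?_⟩
    rw [← Submodule.map_iSup, h1.2, Submodule.map_top, LinearMap.range_eq_top]
    exact e.surjective
  · have := h.gradedMonoid
    refine { one_mem := ⟨1, this.one_mem, map_one e⟩, mul_mem := ?_ }
    rintro i j _ _ ⟨x, hx, rfl⟩ ⟨y, hy, rfl⟩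
    exact ⟨x * y, this.mul_mem hx hy, map_mul e x y⟩
  · rintro n _ ⟨x, hx, rfl⟩
    have key : (⨆ (i : ℕ) (j : ℕ) (_ : i + j = n),
        LinearMap.range (TensorProduct.mapIncl (𝒜 i) (𝒜 j))) ≤
        (⨆ (i : ℕ) (j : ℕ) (_ : i + j = n), LinearMap.range (TensorProduct.mapIncl
          ((𝒜 i).map e.toLinearMap) ((𝒜 j).map e.toLinearMap))).comap
            (TensorProduct.map e.toLinearMap e.toLinearMap) := by
      refine iSup_le fun i => iSup_le fun j => iSup_le fun hij => ?_
      rintro _ ⟨t, rfl⟩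
      rw [Submodule.mem_comap]
      refine Submodule.mem_iSup_of_mem i <| Submodule.mem_iSup_of_mem j <|
        Submodule.mem_iSup_of_mem hij ?_
      induction t with
      | zero => simp
      | add x y hx hy =>
        simp only [map_add]
        exact add_mem hx hy
      | tmul x y =>
        exact ⟨⟨e x, x, x.2, rfl⟩ ⊗ₜ ⟨e y, y, y.2, rfl⟩, rfl⟩
    have h1 := key (h.comul_mem n x hx)
    rw [Submodule.mem_comap, ← hcomul] at h1
    exact h1
  · rintro n _ ⟨x, hx, rfl⟩ hn
    exact (hcounit x).trans (h.counit_eq_zero n x hx hn)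
  · rintro n _ ⟨x, hx, rfl⟩
    refine ⟨S x, h.antipode_mem n x hx, ?_⟩
    simp

/-! ### The Hopf algebra isomorphism. -/

noncomputable section

open QSh QuasiShuffleAlphabet

theorem isGradedHopfAlgebra_QY :
    IsGradedHopfAlgebra ℚ (antipode : QY →ₗ[ℚ] QY) gradeY :=
  isGradedHopfAlgebra YLetter.wt fun a b c h => by
    have : (⟨a.k + b.k, a.m + b.m⟩ : YLetter) = c := Option.some.inj h
    subst this
    simp only [YLetter.wt, PNat.add_coe]
    omega

/-- The map `φ_#` as an isomorphism of algebras. -/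
def phiAlgEquiv : QY ≃ₐ[ℚ] QB0 :=
  AlgEquiv.ofLinearEquiv (LinearEquiv.ofBijective phiSharp phiSharp_bijective)
    (Subtype.ext phiQB_one) fun x y => Subtype.ext (phiQB_mul x y)

theorem counit_phiSharp (x : QY) :
    CoalgebraStruct.counit (R := ℚ) (phiSharp x) = CoalgebraStruct.counit (R := ℚ) x :=
  counit_phiQB x

/-- By flatness over ℚ, ℚ⟨B⟩⁰ ⊗ ℚ⟨B⟩⁰ embeds in ℚ⟨B⟩ ⊗ ℚ⟨B⟩, where the identity is `regDec_phiQB`.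
-/
theorem comul_phiSharp (x : QY) : CoalgebraStruct.comul (R := ℚ) (phiSharp x) =
    TensorProduct.map phiSharp phiSharp (CoalgebraStruct.comul (R := ℚ) x) := by
  have hinj : Function.Injective (TensorProduct.map QB0.val.toLinearMap QB0.val.toLinearMap) :=
    TensorProduct.map_injective_of_flat_flat _ _ Subtype.val_injective Subtype.val_injective
  refine hinj ?_
  rw [TensorProduct.map_map]
  refine Eq.trans ?_ (regDec_phiQB x)
  change TensorProduct.map _ _ (TensorProduct.map _ _ _) = _
  rw [TensorProduct.map_map]
  rfl

/-- The map `φ_#` as an isomorphism of bialgebras. -/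
def phiBialgEquiv : QY ≃ₐc[ℚ] QB0 :=
  { phiAlgEquiv with
    map_smul' := map_smul phiAlgEquiv
    counit_comp := LinearMap.ext counit_phiSharp
    map_comp_comul := LinearMap.ext fun x => (comul_phiSharp x).symm }

theorem map_phiSharp_gradeY (n : ℕ) : (gradeY n).map phiSharp = gradeB0 n := by
  ext y
  constructor
  · rintro ⟨x, hx, rfl⟩
    change phiQB x ∈ QSh.grade BLetter.wt n
    rw [mem_grade_iff, phiQB_gradeProj, (mem_grade_iff _).1 hx]
  · intro hy
    obtain ⟨x, rfl⟩ := phiSharp_bijective.surjective y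
    change phiQB x ∈ QSh.grade BLetter.wt n at hy
    rw [mem_grade_iff, phiQB_gradeProj] at hy
    exact ⟨x, (mem_grade_iff _).2 (phiQB_injective hy), rfl⟩

end

theorem mainTheorem2 :
    ∃ (SY : QY →ₗ[ℚ] QY) (SB : QB0 →ₗ[ℚ] QB0) (e : QY ≃ₐc[ℚ] QB0),
      IsGradedHopfAlgebra ℚ SY gradeY ∧
      IsGradedHopfAlgebra ℚ SB gradeB0 ∧
      (∀ x, e x = phiSharp x) ∧
      (∀ x, phiSharp (SY x) = SB (phiSharp x)) ∧
      (∀ n, (gradeY n).map phiSharp = gradeB0 n) ∧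
      phiSharp ∘ₗ swapY = tau ∘ₗ phiSharp := by
  -- The antipode of ℚ⟨B⟩⁰ is the conjugate of that of ℚ⟨Y^bi⟩ by φ_#, so compatibility with
  -- antipodes only needs cancellation of φ_# with its inverse.
  have h := isGradedHopfAlgebra_QY.of_algEquiv phiAlgEquiv counit_phiSharp comul_phiSharp
  rw [show (fun n => (gradeY n).map phiAlgEquiv.toLinearMap) = gradeB0 from
    funext map_phiSharp_gradeY] at h
  refine ⟨_, _, phiBialgEquiv, isGradedHopfAlgebra_QY, h, fun x => rfl, fun x => ?_,
    map_phiSharp_gradeY, phiSharp_comp_swapY⟩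
  exact congrArg (fun z => phiSharp (QSh.antipode z)) (phiAlgEquiv.symm_apply_apply x).symm
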